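/- **Notation.** Let $\mathbb F$ be a field, $k\ge 1$, and let $P(\lambda)=\sum_{i=0}^k A_i\lambda^i\in\mathbb F[\lambda]^{n\times n}$ be a matrix polynomial of grade $k$ (any $A_i$ may be zero). Write $a:b$ for $a,a+1,\dots,b$ (empty if $a>b$). All $kn\times kn$ matrices are viewed as $k\times k$ block-matrices with $n\times n$ blocks. *Elementary matrices.* For $B\in\mathbb F^{n\times n}$ put $M_0(B)=\mathrm{diag}(I_{(k-1)n},B)$, $M_{-k}(B)=\mathrm{diag}(B,I_{(k-1)n})$ and, for $i=1:k-1$, $$M_i(B)=I_{(k-i-1)n}\oplus\begin{bmatrix}B&I_n\\I_n&0\end{bmatrix}\oplus I_{(i-1)n},\qquad M_{-i}(B)=I_{(k-i-1)n}\oplus\begin{bmatrix}0&I_n\\I_n&B\end{bmatrix}\oplus I_{(i-1)n}.$$ Put $M_i^P=M_i(-A_i)$ for $i=0:k-1$, $M_{-i}^P=M_{-i}(A_i)$ for $i=1:k$, and $M^P_{\mathbf t}=M^P_{t_1}\cdots M^P_{t_r}$ for a tuple of indices $\mathbf t=(t_1,\dots,t_r)$, with $M^P_{\emptyset}=I_{kn}$.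 *Index tuples.* Write $\mathrm{rev}(\mathbf t)=(t_r,\dots,t_1)$, $-\mathbf t=(-t_1,\dots,-t_r)$, $\mathbf t+k=(t_1+k,\dots,t_r+k)$, and $(\mathbf s,\mathbf t)$ for concatenation. The tuple $\mathbf t$ satisfies the *SIP* if, whenever $t_a=t_b$ with $a<b$, there is $c$ with $a<c<b$ and $t_c=t_a+1$. Two tuples are *equivalent* ($\sim$) if one is obtained from the other by finitely many interchanges of adjacent entries $x\neq y$ with $|x-y|\ne1$. A tuple of nonnegative integers that satisfies the SIP is equivalent to a unique tuple in column standard form, i.e. of the form $(a_s:b_s,\dots,a_1:b_1)$ with $b_s>\cdots>b_1\ge0$ and $0\le a_j\le b_j$; let $\mathfrak h(\mathbf t)=s$ be its number of strings. *Proper generalized Fiedler pencils.* Let $\{C_0,C_1\}$ be a partition of $\{0:k\}$ with $0\in C_0$, $k\in C_1$, let $\mathbf q$ and $\mathbf z$ be permutations of $C_0$ and $-C_1$ (tuples listing every element exactly once), and let $K_{\mathbf q,\mathbf z}(\lambda)=\lambda M^P_{\mathbf z}-M^P_{\mathbf q}$ be the associated proper generalized Fiedler pencil. A *simple pair* of it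 is a pair $(\widehat{\mathbf q},h)$ with $h\in\{0:k-1\}$ such that, for some tuple $\mathbf m$, $\mathbf z\sim(\mathbf m,-k:-h-1)$ and $\widehat{\mathbf q}=(-\mathrm{rev}(\mathbf m),\mathbf q)$ is a permutation of $\{0:h\}$. *Block Kronecker pencils.* Let $L_s(\lambda)$ be the $s\times(s+1)$ pencil with entries $-1$ in positions $(i,i)$, $\lambda$ in positions $(i,i+1)$, and $0$ elsewhere. A $(p,n,q,n)$-block Kronecker pencil with body $M(\lambda)$ is $$\left[\begin{array}{c|c}M(\lambda)&L_q(\lambda)^T\otimes I_n\\\hline L_p(\lambda)\otimes I_n&0\end{array}\right],\qquad M(\lambda)=\lambda M_1+M_0\in\mathbb F[\lambda]^{(q+1)n\times(p+1)n}$$ (with $p=0$ or $q=0$ allowed). When $p+q+1=k$, the body satisfies the *AS condition* for $P(\lambda)$ if $\sum_{i+j=k+2-s}[M_1]_{ij}+\sum_{i+j=k+1-s}[M_0]_{ij}=A_s$ for $s=0:k$, where $[\,\cdot\,]_{ij}$ are the $n\times n$ blocks. *Block-permutations.* For a permutation $\mathbf c=(c_1,\dots,c_k)$ of $\{1:k\}$,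 $\Pi^n_{\mathbf c}$ has $(c_i,i)$ block $I_n$ for $i=1:k$ and zero blocks elsewhere; $H^{\mathcal B}$ denotes the block-transpose, whose $(i,j)$ block is the $(j,i)$ block of $H$. If $(\Pi^n_{\boldsymbol\ell})^{\mathcal B}L(\lambda)\Pi^n_{\mathbf r}$ is a $(p,n,q,n)$-block Kronecker pencil with $p+q+1=k$, then the *wing block-rows* (resp. *wing block-columns*) of $L(\lambda)$ relative to $(\boldsymbol\ell,\mathbf r,p,q)$ are those that are moved to the last $p$ block-rows (resp. last $q$ block-columns). Let $\mathbf{id}=(1:k)$, and let $e_i$ be the $i$th column of $I_k$. **Theorem.** Every proper generalized Fiedler pencil $K_{\mathbf q,\mathbf z}(\lambda)$ has a simple pair. For every simple pair $(\widehat{\mathbf q},h)$ of $K_{\mathbf q,\mathbf z}(\lambda)$, set $p:=\mathfrak h(\widehat{\mathbf q})-1$ and $q:=\mathfrak h(\mathrm{rev}(\widehat{\mathbf q}))+k-h-2$. Then $p,q\ge 0$, $p+q+1=k$, and there are block-permutation matrices $\Pi^n_{\boldsymbol\ell}$, $\Pi^n_{\mathbf r}$ such that $$(\Pi^n_{\boldsymbol\ell})^{\mathcal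 B}K_{\mathbf q,\mathbf z}(\lambda)\Pi^n_{\mathbf r}=\left[\begin{array}{c|c}M(\lambda)&L_q(\lambda)^T\otimes I_n\\\hline L_p(\lambda)\otimes I_n&0\end{array}\right]$$ is a $(p,n,q,n)$-block Kronecker pencil whose body $M(\lambda)$ satisfies the AS condition for $P(\lambda)$, and moreover: (a) each wing block-column of $(\Pi^n_{\boldsymbol\ell})^{\mathcal B}K_{\mathbf q,\mathbf z}(\lambda)$ relative to $(\mathbf{id},\mathbf r,p,q)$ is of the form $-e_i\otimes I_n+\lambda e_{i+1}\otimes I_n$ for some $1\le i\le q$, and the set of their positions is exactly the set of those $j\in\{1:k\}$ for which both $(\mathbf q,k-j)$ and $(\mathbf z+k,j-1)$ satisfy the SIP; (b) each wing block-row of $K_{\mathbf q,\mathbf z}(\lambda)\Pi^n_{\mathbf r}$ relative to $(\boldsymbol\ell,\mathbf{id},p,q)$ is of the form $-e_i^T\otimes I_n+\lambda e_{i+1}^T\otimes I_n$ for some $1\le i\le p$, and the set of their positions is exactly the set of those $j\in\{1:k\}$ for which both $(k-j,\mathbf q)$ and $(j-1,\mathbf z+k)$ satisfy the SIP. -/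

import Mathlib

open Polynomial
open scoped Kronecker

namespace FiedlerPencil

/-! ### Index tuples

An index tuple is a `List ℤ`; concatenation is `++`, reversal is `List.reverse`. -/

/-- The string `(a : b) = (a, a + 1, …, b)`, which is empty if `b < a`. -/
def string (a b : ℤ) : List ℤ :=
  (List.range (b + 1 - a).toNat).map (fun i : ℕ => a + (i : ℤ))

/-- The index tuple `t` is a permutation of the finite set `S`: it lists each element of `S`
exactly once. -/
def IsPermutationOf (t : List ℤ) (S : Finset ℤ) : Prop :=
  t.Nodup ∧ ∀ x : ℤ, x ∈ t ↔ x ∈ S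

/-- The Successor Infix Property: between any two equal entries `x` there is an entry `x + 1`. -/
def SIP (t : List ℤ) : Prop :=
  ∀ a b : Fin t.length, a < b → t.get a = t.get b →
    ∃ c : Fin t.length, a < c ∧ c < b ∧ t.get c = t.get a + 1

/-- Interchange of two distinct commuting indices in adjacent positions. -/
inductive AdjacentSwap : List ℤ → List ℤ → Prop
  | swap (u v : List ℤ) (a b : ℤ) (hne : a ≠ b) (hcomm : |a - b| ≠ 1) :
      AdjacentSwap (u ++ a :: b :: v) (u ++ b :: a :: v)

/-- Equivalence of index tuples: finitely many interchanges of distinct commuting indices in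
adjacent positions (the relation `AdjacentSwap` is symmetric). -/
def TupleEquiv (t t' : List ℤ) : Prop :=
  Relation.ReflTransGen AdjacentSwap t t'

/-- A list `[(a_s, b_s), …, (a_1, b_1)]` describes a tuple `(a_s : b_s, …, a_1 : b_1)` in column
standard form if `b_s > ⋯ > b_1 ≥ 0` and `0 ≤ a_j ≤ b_j` for all `j`. -/
def IsColumnStandard (S : List (ℤ × ℤ)) : Prop :=
  S.Pairwise (fun x y => y.2 < x.2) ∧ ∀ x ∈ S, 0 ≤ x.1 ∧ x.1 ≤ x.2

/-- The tuple `(a_s : b_s, …, a_1 : b_1)` described by the list of pairs `(a_j, b_j)`. -/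
def concatStrings (S : List (ℤ × ℤ)) : List ℤ :=
  S.flatMap (fun x => string x.1 x.2)

/-- `heads(t)`: the right end points `b_j` of the strings of the column standard form
`(a_s : b_s, …, a_1 : b_1)` of `t`. -/
def heads (t : List ℤ) : Set ℤ :=
  {b | ∃ S : List (ℤ × ℤ), IsColumnStandard S ∧ TupleEquiv t (concatStrings S) ∧
    b ∈ S.map Prod.snd}

/-- `𝔥(t)`: the number of heads of `t`. -/
noncomputable def numHeads (t : List ℤ) : ℕ := (heads t).ncard

/-- `(q, z)` is the pair of index tuples of a proper generalized Fiedler pencil of grade `k`: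
`{C₀, C₁}` is a partition of `{0 : k}` with `0 ∈ C₀` and `k ∈ C₁`, and `q`, `z` are permutations
of `C₀` and `-C₁`. -/
def IsProperGFPPair (k : ℕ) (q z : List ℤ) : Prop :=
  ∃ C₀ C₁ : Finset ℤ, Disjoint C₀ C₁ ∧ C₀ ∪ C₁ = Finset.Icc 0 (k : ℤ) ∧
    (0 : ℤ) ∈ C₀ ∧ (k : ℤ) ∈ C₁ ∧
    IsPermutationOf q C₀ ∧ IsPermutationOf z (C₁.image (fun x => -x))

/-- `(qhat, h)` is the simple pair of the proper generalized Fiedler pencil with index tuples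
`(q, z)`: up to interchanges of commuting indices `z` is `(m, -k : -h-1)`, where
`qhat = (-rev m, q)` is a permutation of `{0 : h}` and `h ∈ {0 : k-1}`. -/
def IsSimplePair (k : ℕ) (q z qhat : List ℤ) (h : ℕ) : Prop :=
  h < k ∧ ∃ m : List ℤ,
    TupleEquiv z (m ++ string (-(k : ℤ)) (-(h : ℤ) - 1)) ∧
    qhat = m.reverse.map (fun x => -x) ++ q ∧
    IsPermutationOf qhat (Finset.Icc 0 (h : ℤ))

/-! ### Matrix polynomials and block matrices

A block matrix with blocks of size `m × n` has index types `Fin r × Fin m` and `Fin s × Fin n`;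
`Matrix.comp` assembles it from its blocks. Block positions in comments are counted from `1`, so
that `i : Fin k` is the position `i + 1`. -/

variable {F : Type*} [Field F]

/-- The matrix polynomial `P` has grade `d`. -/
def HasGrade {α β : Type*} (P : Matrix α β F[X]) (d : ℕ) : Prop :=
  ∀ i j, (P i j).natDegree ≤ d

/-- The coefficient matrix of `λ ^ s` in `P`. -/
def coeffMatrix {α β : Type*} (P : Matrix α β F[X]) (s : ℕ) : Matrix α β F :=
  P.map (fun f => f.coeff s)

/-- The `(i, j)` block of a block matrix. -/
def block {R : Type*} {r s m n : ℕ} (H : Matrix (Fin r × Fin m) (Fin s × Fin n) R)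
    (i : Fin r) (j : Fin s) : Matrix (Fin m) (Fin n) R :=
  Matrix.of fun a b => H (i, a) (j, b)

/-- The block-transpose `H^𝓑`: its `(i, j)` block is the `(j, i)` block of `H`. -/
def blockTranspose {R : Type*} {r s n : ℕ} (H : Matrix (Fin r × Fin n) (Fin s × Fin n) R) :
    Matrix (Fin s × Fin n) (Fin r × Fin n) R :=
  Matrix.comp _ _ _ _ _ (Matrix.of fun i j => block H j i)

/-- The block-permutation matrix `Π_c^n`: its `(c i, i)` blocks are `I_n`, all others are `0`. -/
def blockPerm {R : Type*} [Zero R] [One R] {k : ℕ} (n : ℕ) (c : Equiv.Perm (Fin k)) :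
    Matrix (Fin k × Fin n) (Fin k × Fin n) R :=
  Matrix.comp _ _ _ _ _ (Matrix.of fun i j => if i = c j then 1 else 0)

/-! ### Elementary matrices and proper generalized Fiedler pencils -/

/-- `M_0(B) = diag(I, …, I, B)`. -/
def elemZero (k : ℕ) {n : ℕ} (B : Matrix (Fin n) (Fin n) F) :
    Matrix (Fin k × Fin n) (Fin k × Fin n) F :=
  Matrix.comp _ _ _ _ _ (Matrix.diagonal fun i : Fin k => if (i : ℕ) + 1 = k then B else 1)

/-- `M_{-k}(B) = diag(B, I, …, I)`. -/
def elemNegTop (k : ℕ) {n : ℕ} (B : Matrix (Fin n) (Fin n) F) :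
    Matrix (Fin k × Fin n) (Fin k × Fin n) F :=
  Matrix.comp _ _ _ _ _ (Matrix.diagonal fun i : Fin k => if (i : ℕ) + 1 = 1 then B else 1)

/-- The `k × k` block matrix `diag(I_{(k-i-1)n}, [E₁₁ E₁₂; E₂₁ E₂₂], I_{(i-1)n})`, whose middle
part occupies the block-rows and block-columns `k-i` and `k-i+1`, for `1 ≤ i ≤ k-1`. -/
def elemMiddle (k i : ℕ) {n : ℕ} (E₁₁ E₁₂ E₂₁ E₂₂ : Matrix (Fin n) (Fin n) F) :
    Matrix (Fin k × Fin n) (Fin k × Fin n) F :=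
  Matrix.comp _ _ _ _ _ (Matrix.of fun r c : Fin k =>
    if (r : ℕ) + 1 = k - i ∧ (c : ℕ) + 1 = k - i then E₁₁
    else if (r : ℕ) + 1 = k - i ∧ (c : ℕ) + 1 = k - i + 1 then E₁₂
    else if (r : ℕ) + 1 = k - i + 1 ∧ (c : ℕ) + 1 = k - i then E₂₁
    else if (r : ℕ) + 1 = k - i + 1 ∧ (c : ℕ) + 1 = k - i + 1 then E₂₂
    else if r = c then 1 else 0)

/-- The elementary matrix `M_i(B)` for an index `i ∈ {-k : k-1}`. -/
def elem (k : ℕ) {n : ℕ} (i : ℤ) (B : Matrix (Fin n) (Fin n) F) :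
    Matrix (Fin k × Fin n) (Fin k × Fin n) F :=
  if i = 0 then elemZero k B
  else if i = -(k : ℤ) then elemNegTop k B
  else if 0 < i then elemMiddle k i.natAbs B 1 1 0
  else elemMiddle k i.natAbs 0 1 1 B

/-- `M_i^P`, that is `M_i(-A_i)` for `i = 0 : k-1`, and `M_i(A_{-i})` for `i = -k : -1`, where
`A_s` are the coefficients of `P`. -/
def elemOf (k : ℕ) {n : ℕ} (P : Matrix (Fin n) (Fin n) F[X]) (i : ℤ) :
    Matrix (Fin k × Fin n) (Fin k × Fin n) F :=
  if 0 ≤ i then elem k i (-coeffMatrix P i.natAbs) else elem k i (coeffMatrix P i.natAbs)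

/-- `M_t^P = M_{t_1}^P ⋯ M_{t_r}^P`. -/
def elemProd (k : ℕ) {n : ℕ} (P : Matrix (Fin n) (Fin n) F[X]) (t : List ℤ) :
    Matrix (Fin k × Fin n) (Fin k × Fin n) F :=
  (t.map (elemOf k P)).prod

/-- The pencil `K_{q,z}(λ) = λ M_z^P - M_q^P`. -/
noncomputable def gfp (k : ℕ) {n : ℕ} (P : Matrix (Fin n) (Fin n) F[X]) (q z : List ℤ) :
    Matrix (Fin k × Fin n) (Fin k × Fin n) F[X] :=
  (X : F[X]) • (elemProd k P z).map C - (elemProd k P q).map C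

/-! ### Block Kronecker pencils and the antidiagonal sum condition -/

/-- The `s × (s + 1)` pencil `L_s(λ)` with `-1` in positions `(i, i)` and `λ` in positions
`(i, i + 1)`. -/
noncomputable def pencilL (F : Type*) [Field F] (s : ℕ) : Matrix (Fin s) (Fin (s + 1)) F[X] :=
  Matrix.of fun i j =>
    if (j : ℕ) = (i : ℕ) then -1 else if (j : ℕ) = (i : ℕ) + 1 then X else 0

/-- The block matrix `[M(λ), L_q(λ)ᵀ ⊗ I_m; L_p(λ) ⊗ I_n, 0]`; it is the
`(p, n, q, m)`-block Kronecker pencil with body `M` when `M` is a pencil. -/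
noncomputable def blockKronecker (p n q m : ℕ)
    (M : Matrix (Fin (q + 1) × Fin m) (Fin (p + 1) × Fin n) F[X]) :
    Matrix ((Fin (q + 1) × Fin m) ⊕ (Fin p × Fin n))
      ((Fin (p + 1) × Fin n) ⊕ (Fin q × Fin m)) F[X] :=
  Matrix.fromBlocks M
    ((pencilL F q).transpose ⊗ₖ (1 : Matrix (Fin m) (Fin m) F[X]))
    (pencilL F p ⊗ₖ (1 : Matrix (Fin n) (Fin n) F[X]))
    0

/-- Split `k = a + b` block positions into the first `a` and the last `b` ones. -/
def blockSplit {a b k : ℕ} (n : ℕ) (hab : a + b = k) :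
    (Fin a × Fin n) ⊕ (Fin b × Fin n) ≃ Fin k × Fin n :=
  (Equiv.sumProdDistrib (Fin a) (Fin b) (Fin n)).symm.trans
    (Equiv.prodCongr (finSumFinEquiv.trans (finCongr hab)) (Equiv.refl (Fin n)))

/-- The `k × k` block-pencil `C`, with `k = p + q + 1`, is a `(p, n, q, n)`-block Kronecker pencil
with body `M`, where the body occupies the first `q + 1` block-rows and the first `p + 1`
block-columns. -/
def IsBlockKroneckerWithBody {k n : ℕ} (p q : ℕ) (hpq : p + q + 1 = k)
    (C : Matrix (Fin k × Fin n) (Fin k × Fin n) F[X])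
    (M : Matrix (Fin (q + 1) × Fin n) (Fin (p + 1) × Fin n) F[X]) : Prop :=
  HasGrade M 1 ∧
    C = Matrix.reindex
      (blockSplit n (show (q + 1) + p = k by omega))
      (blockSplit n (show (p + 1) + q = k by omega))
      (blockKronecker p n q n M)

/-- The antidiagonal sum `AS(M, s) = ∑_{i+j=k+2-s} [M₁]_{ij} + ∑_{i+j=k+1-s} [M₀]_{ij}` of a pencil
`M = λ M₁ + M₀`, where `k = p + q + 1` and the block positions `(i, j)` are counted from `1`. -/
def antidiagSum {p q m n : ℕ} (M : Matrix (Fin (q + 1) × Fin m) (Fin (p + 1) × Fin n) F[X])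
    (s : ℕ) : Matrix (Fin m) (Fin n) F :=
  (∑ i : Fin (q + 1), ∑ j : Fin (p + 1),
    if ((i : ℕ) + 1) + ((j : ℕ) + 1) + s = (p + q + 1) + 2 then
      block (coeffMatrix M 1) i j else 0) +
  (∑ i : Fin (q + 1), ∑ j : Fin (p + 1),
    if ((i : ℕ) + 1) + ((j : ℕ) + 1) + s = (p + q + 1) + 1 then
      block (coeffMatrix M 0) i j else 0)

/-- The AS condition for `P = ∑_{s = 0}^k A_s λ ^ s` with `k = p + q + 1`. -/
def ASCondition {p q m n : ℕ} (M : Matrix (Fin (q + 1) × Fin m) (Fin (p + 1) × Fin n) F[X])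
    (P : Matrix (Fin m) (Fin n) F[X]) : Prop :=
  ∀ s : ℕ, s ≤ p + q + 1 → antidiagSum M s = coeffMatrix P s

/-! ### Wing block-rows and wing block-columns -/

/-- Positions of the wing block-columns relative to `(ℓ, r, p, q)` for any `ℓ`: those
block-columns that right multiplication by `Π_r^n` moves beyond the first `p + 1` positions. -/
def wingColPositions {k : ℕ} (r : Equiv.Perm (Fin k)) (p : ℕ) : Set (Fin k) :=
  {j | ∃ c : Fin k, p + 1 < (c : ℕ) + 1 ∧ r c = j}

/-- Positions of the wing block-rows relative to `(ℓ, r, p, q)` for any `r`: those block-rows that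
left multiplication by `(Π_ℓ^n)^𝓑` moves beyond the first `q + 1` positions. -/
def wingRowPositions {k : ℕ} (l : Equiv.Perm (Fin k)) (q : ℕ) : Set (Fin k) :=
  {j | ∃ c : Fin k, q + 1 < (c : ℕ) + 1 ∧ l c = j}

/-- The `j`-th block-column. -/
def blockCol {R : Type*} {r s m n : ℕ} (H : Matrix (Fin r × Fin m) (Fin s × Fin n) R)
    (j : Fin s) : Matrix (Fin r × Fin m) (Fin n) R :=
  H.submatrix id (fun b => (j, b))

/-- The `i`-th block-row. -/
def blockRow {R : Type*} {r s m n : ℕ} (H : Matrix (Fin r × Fin m) (Fin s × Fin n) R)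
    (i : Fin r) : Matrix (Fin m) (Fin s × Fin n) R :=
  H.submatrix (fun a => (i, a)) id

/-- `e_i ⊗ I_n` with `k` blocks, where `i` is counted from `1`. -/
def unitCol (R : Type*) [Zero R] [One R] (k n i : ℕ) : Matrix (Fin k × Fin n) (Fin n) R :=
  Matrix.of fun x b => if (x.1 : ℕ) + 1 = i ∧ x.2 = b then 1 else 0

/-- `e_iᵀ ⊗ I_n` with `k` blocks, where `i` is counted from `1`. -/
def unitRow (R : Type*) [Zero R] [One R] (k n i : ℕ) : Matrix (Fin n) (Fin k × Fin n) R :=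
  (unitCol R k n i).transpose

end FiedlerPencil

open FiedlerPencil

/-! An elementary matrix with index `i` mixes only two neighbouring block positions. Give position
`a` (counted from 0) the level `k - 1 - a` for the tuple `q`, and the level `a` for `z` shifted by
`k`. Then both coefficients of the pencil are products of the same kind: the factor `i` acts on the
levels `i` and `i - 1` as `[B i, 1; 1, 0]`, each index occurs at most once, and only the relative
order of `x` and `x + 1` in the tuple matters.

For one such product, row `x` is a unit vector when `RowUnit` holds, and column `y` when `ColUnit`
holds. The one in a unit row lies at the end of a climb through consecutive unit columns, and dually
for columns. Between the remaining rows and columns each coefficient `B s` occurs exactly once, at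
the ends of the row climb and the column climb that start at `s`. See `levelEntry_row`,
`levelEntry_col` and `levelEntry_body`, all by induction on the leftmost factor.

In the pencil, `x` lies in `q` exactly when `k - x` does not lie in the shifted `z`. The wings are
the rows, respectively columns, that are unit vectors in both coefficients. By complementarity, the
positions that a climb passes over are wing positions, so a climb does not change the number of body
positions counted so far (`climb_left`, `climb_right`). The local count `not_mem_wings` telescopes
to `rank_add_rank`: the body rows and body columns before position `a` number `a` in all, plus one
if `a` is not in the shifted `z`. With `a = k` this gives `p + q + 1 = k`. With general `a` it
places `-1` and `λ` in neighbouring body columns for each wing row, and each coefficient on the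
antidiagonal required by the AS condition. The permutations only list the body first and the wings
last, each in increasing order.

Finally, `heads_eq` identifies the heads of a permutation of `0 : h` with the failures of `ColUnit`,
`IsSimplePair.colUnit_iff` relates these for `qhat` to the wing columns, and for a tuple without
repetitions the SIP after adding one entry at an end is `ColUnit` or `RowUnit`. -/

namespace FiedlerPencil

/-! ### Relative order of the entries of an index tuple -/

/-- An occurrence of `x` precedes an occurrence of `y` in `t`. -/
def Before (t : List ℤ) (x y : ℤ) : Prop := [x, y].Sublist t

/-- Block-row `x` of the product of the elementary matrices indexed by `t` is a unit vector. -/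
def RowUnit (t : List ℤ) (x : ℤ) : Prop := x ∉ t ∨ Before t (x + 1) x

/-- Block-column `y` of the product of the elementary matrices indexed by `t` is a unit vector. -/
def ColUnit (t : List ℤ) (y : ℤ) : Prop := y ∉ t ∨ Before t y (y + 1)

theorem not_before_nil (x y : ℤ) : ¬ Before [] x y := by simp [Before]

theorem before_cons {i : ℤ} {t : List ℤ} {x y : ℤ} :
    Before (i :: t) x y ↔ (x = i ∧ y ∈ t) ∨ Before t x y := by
  unfold Before
  constructor
  · intro h
    rcases List.sublist_cons_iff.1 h with h | ⟨r, hr, h⟩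
    · exact Or.inr h
    · simp only [List.cons.injEq] at hr
      obtain ⟨rfl, rfl⟩ := hr
      exact Or.inl ⟨rfl, by simpa using h⟩
  · rintro (⟨rfl, h⟩ | h)
    · exact List.Sublist.cons_cons _ (by simpa using h)
    · exact h.cons _

theorem Before.mem_left {t : List ℤ} {x y : ℤ} (h : Before t x y) : x ∈ t :=
  h.subset (by simp)

theorem Before.mem_right {t : List ℤ} {x y : ℤ} (h : Before t x y) : y ∈ t :=
  h.subset (by simp)

theorem before_append {u v : List ℤ} {x y : ℤ} :
    Before (u ++ v) x y ↔ Before u x y ∨ (x ∈ u ∧ y ∈ v) ∨ Before v x y := by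
  induction u with
  | nil => simp [not_before_nil]
  | cons i u ih =>
    simp only [List.cons_append, before_cons, ih, List.mem_append, List.mem_cons]
    tauto

theorem before_reverse {t : List ℤ} {x y : ℤ} : Before t.reverse x y ↔ Before t y x := by
  unfold Before
  rw [← List.reverse_sublist]
  simp

theorem before_map {f : ℤ → ℤ} (hf : Function.Injective f) {t : List ℤ} {x y : ℤ} :
    Before (t.map f) (f x) (f y) ↔ Before t x y := by
  induction t with
  | nil => simp [not_before_nil]
  | cons i t ih => simp [before_cons, ih, hf.eq_iff]

theorem Before.total {t : List ℤ} {x y : ℤ} (hx : x ∈ t) (hy : y ∈ t) (hne : x ≠ y) :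
    Before t x y ∨ Before t y x := by
  induction t with
  | nil => simp at hx
  | cons i t ih =>
    simp only [before_cons]
    rcases List.mem_cons.1 hx with rfl | hx <;> rcases List.mem_cons.1 hy with rfl | hy
    · exact absurd rfl hne
    · tauto
    · tauto
    · have := ih hx hy
      tauto

theorem Before.asymm {t : List ℤ} (ht : t.Nodup) {x y : ℤ} (h : Before t x y) :
    ¬ Before t y x := by
  induction t with
  | nil => exact not_before_nil _ _
  | cons i t ih =>
    rw [List.nodup_cons] at ht
    rw [before_cons] at h ⊢
    rintro (⟨rfl, h1⟩ | h1)
    · rcases h with ⟨rfl, h⟩ | h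
      · exact ht.1 h
      · exact ht.1 h.mem_right
    · rcases h with ⟨rfl, h⟩ | h
      · exact ht.1 h1.mem_right
      · exact ih ht.2 h h1

theorem rowUnit_reverse {t : List ℤ} {x : ℤ} : RowUnit t.reverse x ↔ ColUnit t x := by
  simp [RowUnit, ColUnit, before_reverse]

theorem colUnit_reverse {t : List ℤ} {x : ℤ} : ColUnit t.reverse x ↔ RowUnit t x := by
  simp [RowUnit, ColUnit, before_reverse]

theorem colUnit_cons_of_ne {i : ℤ} {t : List ℤ} {y : ℤ} (hy : y ≠ i) :
    ColUnit (i :: t) y ↔ ColUnit t y := by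
  simp [ColUnit, before_cons, hy]

theorem colUnit_cons_self {i : ℤ} {t : List ℤ} (hi : i ∉ t) :
    ColUnit (i :: t) i ↔ i + 1 ∈ t := by
  have : ¬ Before t i (i + 1) := fun h => hi h.mem_left
  simp [ColUnit, before_cons, this]

theorem rowUnit_cons {i : ℤ} {t : List ℤ} (hi : i ∉ t) {x : ℤ} :
    RowUnit (i :: t) x ↔ x ≠ i ∧ (x = i - 1 ∨ RowUnit t x) := by
  have h0 : ∀ y, ¬ Before t y i := fun y h => hi h.mem_right
  have h1 : x + 1 = i ↔ x = i - 1 := by omega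
  simp only [RowUnit, before_cons, List.mem_cons, h1, not_or]
  by_cases h2 : x = i
  · subst h2; simp [hi, h0]
  · by_cases h3 : x = i - 1
    · simp [h3]; tauto
    · simp [h2, h3]

/-! ### Entries of products of elementary matrices

Block positions are indexed by levels, so that the elementary matrix with index `i` acts on the
levels `i` and `i - 1`. -/

/-- The entries, indexed by levels, of the product of the elementary matrices
`[B i, 1; 1, 0]` on the levels `i`, `i - 1` (of `B 0` on the level `0` if `i = 0`). -/
def levelEntry {S : Type*} [Ring S] (B : ℤ → S) : List ℤ → ℤ → ℤ → S
  | [], x, y => if x = y then 1 else 0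
  | i :: t, x, y =>
    if x = i then B i * levelEntry B t i y + (if i = 0 then 0 else levelEntry B t (i - 1) y)
    else if x = i - 1 then levelEntry B t i y
    else levelEntry B t x y

/-- `u` is the first level from `s` on which fails `U`, and `s, …, u` are entries of `t`. -/
def IsClimb (t : List ℤ) (U : ℤ → Prop) (s u : ℤ) : Prop :=
  s ≤ u ∧ u ∈ t ∧ ¬ U u ∧ ∀ y, s ≤ y → y < u → y ∈ t ∧ U y

theorem IsClimb.cons_col {i : ℤ} {t : List ℤ} (hi : i ∉ t) {s u : ℤ}
    (h : IsClimb t (ColUnit t) s u) : IsClimb (i :: t) (ColUnit (i :: t)) s u := by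
  obtain ⟨h1, h2, h3, h4⟩ := h
  have hne : ∀ y ∈ t, y ≠ i := by rintro y hy rfl; exact hi hy
  refine ⟨h1, List.mem_cons_of_mem _ h2, ?_, fun y hy hy' => ?_⟩
  · rwa [colUnit_cons_of_ne (hne _ h2)]
  · obtain ⟨h5, h6⟩ := h4 y hy hy'
    exact ⟨List.mem_cons_of_mem _ h5, (colUnit_cons_of_ne (hne _ h5)).2 h6⟩

/-- A new leftmost factor `i` precedes `i - 1`, so level `i - 1` becomes a unit row and a climb that
used to stop there goes one step further, to the nonunit row `i`. -/
theorem IsClimb.cons_row {i : ℤ} {t : List ℤ} (hi : i ∉ t) {s u : ℤ}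
    (h : IsClimb t (RowUnit t) s u) :
    IsClimb (i :: t) (RowUnit (i :: t)) s (if u = i - 1 then i else u) := by
  obtain ⟨h1, h2, h3, h4⟩ := h
  have hne : ∀ y ∈ t, y ≠ i := by rintro y hy rfl; exact hi hy
  have key : ∀ y, s ≤ y → y < u → y ∈ i :: t ∧ RowUnit (i :: t) y := fun y hy hy' => by
    obtain ⟨h5, h6⟩ := h4 y hy hy'
    exact ⟨List.mem_cons_of_mem _ h5, (rowUnit_cons hi).2 ⟨hne _ h5, Or.inr h6⟩⟩
  split_ifs with hu
  · refine ⟨by omega, by simp, by simp [rowUnit_cons hi], fun y hy hy' => ?_⟩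
    by_cases hyu : y < u
    · exact key y hy hyu
    · obtain rfl : y = u := by omega
      exact ⟨List.mem_cons_of_mem _ h2, (rowUnit_cons hi).2 ⟨hne _ h2, Or.inl hu⟩⟩
  · exact ⟨h1, List.mem_cons_of_mem _ h2, by simp [rowUnit_cons hi, hu, h3], key⟩

theorem isClimb_cons_col_self {i : ℤ} {t : List ℤ} (hi : i ∉ t) {u : ℤ}
    (h0 : i + 1 ∉ t → u = i) (h1 : i + 1 ∈ t → IsClimb t (ColUnit t) (i + 1) u) :
    IsClimb (i :: t) (ColUnit (i :: t)) i u := by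
  by_cases h : i + 1 ∈ t
  · obtain ⟨h2, h3, h4, h5⟩ := (h1 h).cons_col hi
    refine ⟨by omega, h3, h4, fun y hy hy' => ?_⟩
    by_cases hyi : y = i
    · subst hyi
      exact ⟨by simp, (colUnit_cons_self hi).2 h⟩
    · exact h5 y (by omega) hy'
  · obtain rfl := h0 h
    exact ⟨le_rfl, by simp, by rwa [colUnit_cons_self hi], fun y _ _ => by omega⟩

variable {S : Type*} [Ring S] (B : ℤ → S)

/-- The leftmost factor `i` copies row `i` of the remaining product into row `i - 1` and changes no
other row except `i`. Row `i` of the remaining product is itself a unit row because `i` does not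
recur. -/
theorem levelEntry_row {t : List ℤ} (ht : t.Nodup) {x : ℤ} (hx : RowUnit t x) :
    ∃ u, (∀ y, levelEntry B t x y = if y = u then 1 else 0) ∧
      (x + 1 ∉ t → u = x) ∧ (x + 1 ∈ t → IsClimb t (ColUnit t) (x + 1) u) := by
  induction t generalizing x with
  | nil => exact ⟨x, fun y => by simp [levelEntry, eq_comm], fun _ => rfl, by simp⟩
  | cons i t ih =>
    rw [List.nodup_cons] at ht
    obtain ⟨hi, ht⟩ := ht
    obtain ⟨hxi, hx⟩ := (rowUnit_cons hi).1 hx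
    by_cases hx1 : x = i - 1
    · obtain ⟨u, hu, h0, h1⟩ := ih ht (x := i) (Or.inl hi)
      refine ⟨u, fun y => by simp [levelEntry, hx1, hu], fun h => ?_, fun _ => ?_⟩
      · exact absurd (by simp [hx1]) h
      · rw [show x + 1 = i by omega]
        exact isClimb_cons_col_self hi h0 h1
    · obtain ⟨u, hu, h0, h1⟩ := ih ht (hx.resolve_left hx1)
      have hne : x + 1 ≠ i := by omega
      refine ⟨u, fun y => by simp [levelEntry, hxi, hx1, hu], fun h => h0 ?_, fun h => ?_⟩
      · exact fun h' => h (List.mem_cons_of_mem _ h')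
      · exact (h1 ((List.mem_cons.1 h).resolve_left hne)).cons_col hi

/-- The leftmost factor `i` acts on a unit column by moving a one in row `i - 1` to row `i`. Levels
are restricted to nonnegative values since the recursion also fills a meaningless row `-1` when `i =
0`. -/
theorem levelEntry_col {t : List ℤ} (ht : t.Nodup) {y : ℤ} (hy0 : 0 ≤ y) (hy : ColUnit t y)
    (hpos : ∀ i ∈ t, 0 ≤ i) :
    ∃ u, (∀ x, 0 ≤ x → levelEntry B t x y = if x = u then 1 else 0) ∧
      (y + 1 ∉ t → u = y) ∧ (y + 1 ∈ t → IsClimb t (RowUnit t) (y + 1) u) := by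
  induction t with
  | nil => exact ⟨y, fun x _ => by simp [levelEntry], fun _ => rfl, by simp⟩
  | cons i t ih =>
    rw [List.nodup_cons] at ht
    obtain ⟨hi, ht⟩ := ht
    have hi0 : 0 ≤ i := hpos i (by simp)
    have hyt : ColUnit t y := by
      by_cases h : y = i
      · subst h; exact Or.inl hi
      · exact (colUnit_cons_of_ne h).1 hy
    obtain ⟨u, hu, h0, h1⟩ := ih ht hyt (fun j hj => hpos j (List.mem_cons_of_mem _ hj))
    -- A one in row `i` would bring `B i` into the column. It could sit there only for `y = i` with
    -- `i + 1 ∉ t`, and then `ColUnit` fails for the longer tuple.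
    have hui : u ≠ i := by
      rintro rfl
      by_cases h : y + 1 ∈ t
      · exact hi (h1 h).2.1
      · obtain rfl := h0 h
        exact h ((colUnit_cons_self hi).1 hy)
    have hu0 : 0 ≤ u := by
      by_cases h : y + 1 ∈ t
      · have := (h1 h).1; omega
      · rw [h0 h]; exact hy0
    refine ⟨if u = i - 1 then i else u, fun x hx => ?_, fun h => ?_, fun h => ?_⟩
    · rw [levelEntry]
      by_cases hxi : x = i
      · rw [if_pos hxi, hu i hi0, if_neg hui.symm, mul_zero, zero_add]
        by_cases hiz : i = 0
        · rw [if_pos hiz, if_neg (by split_ifs <;> omega)]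
        · rw [if_neg hiz, hu _ (by omega)]
          exact if_congr (by split_ifs <;> omega) rfl rfl
      · rw [if_neg hxi]
        by_cases hx1 : x = i - 1
        · rw [if_pos hx1, hu i hi0, if_neg hui.symm, if_neg (by split_ifs <;> omega)]
        · rw [if_neg hx1, hu x hx]
          exact if_congr (by split_ifs <;> omega) rfl rfl
    · have hm : y + 1 ∉ t := fun h' => h (List.mem_cons_of_mem _ h')
      have : y + 1 ≠ i := fun h' => h (by simp [h'])
      rw [h0 hm, if_neg (by omega)]
    · by_cases hm : y + 1 ∈ t
      · exact (h1 hm).cons_row hi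
      · have h2 : y + 1 = i := (List.mem_cons.1 h).resolve_right hm
        rw [h0 hm, if_pos (by omega), h2]
        exact ⟨le_rfl, by simp, by simp [rowUnit_cons hi], fun y _ _ => by omega⟩

/-- Before the factor `i` is applied on the left, row `i` is a unit row. Applying it adds one new
coefficient `B i`, and moves the coefficients of row `i - 1` into row `i`; no two coefficients are
ever multiplied. -/
theorem levelEntry_body {t : List ℤ} (ht : t.Nodup) (hpos : ∀ i ∈ t, 0 ≤ i) :
    ∃ ρ γ : ℤ → ℤ,
      (∀ s ∈ t, IsClimb t (RowUnit t) s (ρ s) ∧ IsClimb t (ColUnit t) s (γ s)) ∧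
      ∀ x y, 0 ≤ x → 0 ≤ y → ¬ RowUnit t x → ¬ ColUnit t y →
        levelEntry B t x y = ∑ s ∈ t.toFinset, if x = ρ s ∧ y = γ s then B s else 0 := by
  induction t with
  | nil => exact ⟨id, id, by simp, fun x y _ _ hx => by simp [RowUnit] at hx⟩
  | cons i t ih =>
    rw [List.nodup_cons] at ht
    obtain ⟨hi, ht⟩ := ht
    have hi0 : 0 ≤ i := hpos i (by simp)
    have hpos' : ∀ j ∈ t, 0 ≤ j := fun j hj => hpos j (List.mem_cons_of_mem _ hj)
    have hne : ∀ y ∈ t, y ≠ i := by rintro y hy rfl; exact hi hy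
    obtain ⟨ρ, γ, hργ, hbody⟩ := ih ht hpos'
    obtain ⟨w, hw, hw0, hw1⟩ := levelEntry_row B ht (x := i) (Or.inl hi)
    -- The new coefficient goes to row `i` and to the column `w` of the one in the old row `i`.
    refine ⟨fun s => if s = i then i else if ρ s = i - 1 then i else ρ s,
      fun s => if s = i then w else γ s, fun s hs => ?_, fun x y hx hy hxt hyt => ?_⟩
    · dsimp only
      rcases List.mem_cons.1 hs with rfl | hs
      · rw [if_pos rfl, if_pos rfl]
        exact ⟨⟨le_rfl, by simp, by simp [rowUnit_cons hi], fun y _ _ => by omega⟩,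
          isClimb_cons_col_self hi hw0 hw1⟩
      · rw [if_neg (hne _ hs), if_neg (hne _ hs)]
        exact ⟨(hργ s hs).1.cons_row hi, (hργ s hs).2.cons_col hi⟩
    have hx1 : x ≠ i - 1 := fun h => hxt ((rowUnit_cons hi).2 ⟨by omega, Or.inl h⟩)
    have hsum : ∑ s ∈ (i :: t).toFinset, (if x = (if s = i then i else if ρ s = i - 1 then i
        else ρ s) ∧ y = (if s = i then w else γ s) then B s else 0) =
        (if x = i ∧ y = w then B i else 0) +
        ∑ s ∈ t.toFinset, if (if x = i then i - 1 else x) = ρ s ∧ y = γ s then B s else 0 := by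
      rw [List.toFinset_cons, Finset.sum_insert (by simpa using hi)]
      congr 1
      · simp
      · refine Finset.sum_congr rfl fun s hs => ?_
        have hs := List.mem_toFinset.1 hs
        have h1 := hne _ (hργ s hs).1.2.1
        rw [if_neg (hne _ hs), if_neg (hne _ hs)]
        refine if_congr (and_congr_left fun _ => ?_) rfl rfl
        split_ifs <;> omega
    rw [hsum]
    -- the remaining sum is an entry of the shorter product
    have hrest : ∀ x', 0 ≤ x' → x' ≠ i → (x' ∈ t → ¬ RowUnit t x') → (x' ∉ t → x' = i - 1) →
        levelEntry B t x' y = ∑ s ∈ t.toFinset, if x' = ρ s ∧ y = γ s then B s else 0 := by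
      intro x' hx' hx'i hmem hnmem
      -- If `y = i` was a unit column of the shorter product, its one sits in row `i`. If `x'` is
      -- not in `t`, then `x' = i - 1` is a unit row whose one lies in a unit column. Both give
      -- zero.
      by_cases hyi : y = i
      · subst hyi
        obtain ⟨u, hu, hu0, -⟩ := levelEntry_col B ht hy (Or.inl hi) hpos'
        rw [colUnit_cons_self hi] at hyt
        rw [hu _ hx', hu0 hyt, if_neg hx'i, Finset.sum_eq_zero]
        intro s hs
        exact if_neg fun h => hne _ (hργ s (List.mem_toFinset.1 hs)).2.2.1 h.2.symm
      · rw [colUnit_cons_of_ne hyi] at hyt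
        by_cases hm : x' ∈ t
        · exact hbody _ _ hx' hy (hmem hm) hyt
        · obtain ⟨u, hu, hu0, -⟩ := levelEntry_row B ht (x := x') (Or.inl hm)
          have h1 := hnmem hm
          have hyx : y ≠ x' := by
            rintro rfl
            exact hyt (Or.inl hm)
          rw [hu, hu0 (by rwa [h1, sub_add_cancel]), if_neg hyx, Finset.sum_eq_zero]
          intro s hs
          refine if_neg fun h => hm ?_
          rw [h.1]
          exact (hργ s (List.mem_toFinset.1 hs)).1.2.1
    by_cases hxi : x = i
    · subst hxi
      rw [levelEntry, if_pos rfl, hw]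
      congr 1
      · simp
      · rw [if_pos rfl]
        split_ifs with hx0
        · rw [Finset.sum_eq_zero]
          intro s hs
          have := hpos' _ (hργ s (List.mem_toFinset.1 hs)).1.2.1
          exact if_neg fun h => by omega
        · refine hrest _ (by omega) (by omega) (fun hm hr => ?_) (fun _ => rfl)
          rcases hr with hr | hr
          · exact hr hm
          · exact hi (by simpa using hr.mem_left)
    · rw [levelEntry, if_neg hxi, if_neg hx1, if_neg (by tauto), zero_add, if_neg hxi]
      have hxt' : ¬ RowUnit t x := fun h => hxt ((rowUnit_cons hi).2 ⟨hxi, Or.inr h⟩)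
      exact hrest x hx hxi (fun _ => hxt') (fun h => absurd (Or.inl h) hxt')

/-! ### Strings -/

theorem mem_string {a b x : ℤ} : x ∈ string a b ↔ a ≤ x ∧ x ≤ b := by
  simp only [string, List.mem_map, List.mem_range]
  constructor
  · rintro ⟨i, hi, rfl⟩
    omega
  · rintro ⟨h1, h2⟩
    exact ⟨(x - a).toNat, by omega, by omega⟩

theorem string_eq_cons {a b : ℤ} (h : a ≤ b) : string a b = a :: string (a + 1) b := by
  rw [string, string, show (b + 1 - a).toNat = (b + 1 - (a + 1)).toNat + 1 by omega,
    List.range_succ_eq_map]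
  simp only [List.map_cons, List.map_map, Nat.cast_zero, add_zero, List.cons.injEq, true_and]
  refine List.map_congr_left fun i _ => ?_
  simp only [Function.comp_apply, Nat.cast_succ]
  ring

theorem string_succ {a b : ℤ} (h : a ≤ b + 1) : string a (b + 1) = string a b ++ [b + 1] := by
  rw [string, string, show (b + 1 + 1 - a).toNat = (b + 1 - a).toNat + 1 by omega,
    List.range_succ, List.map_append, List.map_singleton]
  congr 2
  omega

theorem before_string_succ {a b x : ℤ} :
    Before (string a b) x (x + 1) ↔ a ≤ x ∧ x + 1 ≤ b := by
  constructor
  · intro h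
    exact ⟨(mem_string.1 h.mem_left).1, (mem_string.1 h.mem_right).2⟩
  · rintro ⟨h1, h2⟩
    obtain ⟨n, rfl⟩ : ∃ n : ℕ, b = x + 1 + n := ⟨(b - (x + 1)).toNat, by omega⟩
    induction n with
    | zero =>
      simp only [Nat.cast_zero, add_zero]
      rw [string_succ (by omega), before_append]
      exact Or.inr (Or.inl ⟨mem_string.2 ⟨h1, le_rfl⟩, by simp⟩)
    | succ n ih =>
      rw [Nat.cast_succ, ← add_assoc, string_succ (by omega), before_append]
      exact Or.inl (ih (by omega))

/-! ### Equivalence of index tuples -/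

theorem AdjacentSwap.symm {t t' : List ℤ} (h : AdjacentSwap t t') : AdjacentSwap t' t := by
  obtain ⟨u, v, a, b, hne, hc⟩ := h
  exact .swap u v b a hne.symm (by rwa [abs_sub_comm])

theorem TupleEquiv.refl (t : List ℤ) : TupleEquiv t t := Relation.ReflTransGen.refl

theorem TupleEquiv.trans {t t' t'' : List ℤ} (h : TupleEquiv t t') (h' : TupleEquiv t' t'') :
    TupleEquiv t t'' := Relation.ReflTransGen.trans h h'

theorem TupleEquiv.symm {t t' : List ℤ} (h : TupleEquiv t t') : TupleEquiv t' t := by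
  induction h with
  | refl => exact .refl _
  | tail _ h ih => exact .trans (Relation.ReflTransGen.single h.symm) ih

theorem TupleEquiv.append {t t' : List ℤ} (h : TupleEquiv t t') (w w' : List ℤ) :
    TupleEquiv (w ++ t ++ w') (w ++ t' ++ w') := by
  induction h with
  | refl => exact .refl _
  | tail _ h ih =>
    obtain ⟨u, v, x, y, hne, hc⟩ := h
    refine ih.trans (Relation.ReflTransGen.single ?_)
    simpa using AdjacentSwap.swap (w ++ u) (v ++ w') x y hne hc

theorem TupleEquiv.perm {t t' : List ℤ} (h : TupleEquiv t t') : t.Perm t' := by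
  induction h with
  | refl => exact .refl _
  | tail _ h ih =>
    obtain ⟨u, v, x, y, hne, hc⟩ := h
    exact ih.trans (List.Perm.append_left _ (.swap _ _ _))

/-- Neighbouring indices are never interchanged, so their relative order is an invariant. This makes
`ColUnit` an invariant too. -/
theorem TupleEquiv.before_iff {t t' : List ℤ} (h : TupleEquiv t t') {x y : ℤ}
    (hxy : |x - y| = 1) : Before t x y ↔ Before t' x y := by
  induction h with
  | refl => exact Iff.rfl
  | tail _ h ih =>
    rw [ih]
    obtain ⟨u, v, a, b, hne, hc⟩ := h
    have h1 : ¬ (x = a ∧ y = b) := by rintro ⟨rfl, rfl⟩; exact hc hxy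
    have h2 : ¬ (x = b ∧ y = a) := by
      rintro ⟨rfl, rfl⟩; exact hc (by rwa [abs_sub_comm])
    have h3 : Before (a :: b :: v) x y ↔ Before (b :: a :: v) x y := by
      simp only [before_cons, List.mem_cons]
      tauto
    have h4 : y ∈ a :: b :: v ↔ y ∈ b :: a :: v := (List.Perm.swap _ _ _).mem_iff
    rw [before_append, before_append, h3, h4]

theorem TupleEquiv.colUnit_iff {t t' : List ℤ} (h : TupleEquiv t t') (x : ℤ) :
    ColUnit t x ↔ ColUnit t' x := by
  rw [ColUnit, ColUnit, h.perm.mem_iff, h.before_iff (by simp)]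

theorem tupleEquiv_cons_comm {a : ℤ} {u : List ℤ} (h : ∀ x ∈ u, x ≠ a ∧ |x - a| ≠ 1) :
    TupleEquiv (u ++ [a]) (a :: u) := by
  induction u with
  | nil => exact .refl _
  | cons x u ih =>
    have h1 := (ih fun y hy => h y (List.mem_cons_of_mem _ hy)).append [x] []
    simp only [List.append_nil] at h1
    refine Relation.ReflTransGen.tail h1 ?_
    exact .swap [] u x a (h x (by simp)).1 (h x (by simp)).2

theorem tupleEquiv_append_comm {u w : List ℤ} (h : ∀ x ∈ u, ∀ a ∈ w, x ≠ a ∧ |x - a| ≠ 1) :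
    TupleEquiv (u ++ w) (w ++ u) := by
  induction w with
  | nil => simpa using TupleEquiv.refl u
  | cons a w ih =>
    have h1 := (tupleEquiv_cons_comm fun x hx => h x hx a (by simp)).append [] w
    have h2 := (ih fun x hx b hb => h x hx b (List.mem_cons_of_mem _ hb)).append [a] []
    simp only [List.append_nil, List.nil_append, List.append_assoc,
      List.cons_append] at h1 h2
    exact h1.trans h2

/-! ### Heads -/

theorem concatStrings_append (S S' : List (ℤ × ℤ)) :
    concatStrings (S ++ S') = concatStrings S ++ concatStrings S' := by
  simp [concatStrings]

theorem mem_concatStrings_of_mem {S : List (ℤ × ℤ)} (hS : IsColumnStandard S) {x : ℤ × ℤ}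
    (hx : x ∈ S) : x.2 ∈ concatStrings S :=
  List.mem_flatMap.2 ⟨x, hx, mem_string.2 ⟨(hS.2 x hx).2, le_rfl⟩⟩

/-- Inside a string each entry is followed by its successor. After the right end of a string only
entries below that end occur, so its successor cannot follow. -/
theorem IsColumnStandard.mem_heads_iff {S : List (ℤ × ℤ)} (hS : IsColumnStandard S)
    (hnd : (concatStrings S).Nodup) (b : ℤ) :
    b ∈ S.map Prod.snd ↔ ¬ ColUnit (concatStrings S) b := by
  induction S with
  | nil => simp [ColUnit, concatStrings]
  | cons x S ih =>
    have hS' : IsColumnStandard S :=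
      ⟨(List.pairwise_cons.1 hS.1).2, fun y hy => hS.2 y (List.mem_cons_of_mem _ hy)⟩
    have hc : concatStrings (x :: S) = string x.1 x.2 ++ concatStrings S := by
      simp [concatStrings]
    rw [hc] at hnd ⊢
    obtain ⟨h1, h2, h3⟩ := List.nodup_append.1 hnd
    have hx := hS.2 x (by simp)
    have hlt : ∀ y ∈ concatStrings S, y < x.2 := by
      intro y hy
      obtain ⟨s, hs, hy⟩ := List.mem_flatMap.1 hy
      exact lt_of_le_of_lt (mem_string.1 hy).2 ((List.pairwise_cons.1 hS.1).1 s hs)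
    rw [List.map_cons, List.mem_cons, ih hS' h2]
    simp only [ColUnit, before_append, before_string_succ, List.mem_append, mem_string]
    by_cases hb : b ∈ concatStrings S
    · have h4 := hlt b hb
      have h5 : ¬ (x.1 ≤ b ∧ b ≤ x.2) := fun h => h3 b (mem_string.2 h) b hb rfl
      have h6 : ¬ (x.1 ≤ b ∧ b + 1 ≤ x.2) := fun h => h5 ⟨h.1, by omega⟩
      have h7 : b ≠ x.2 := by omega
      tauto
    · have h4 : ¬ Before (concatStrings S) b (b + 1) := fun h => hb h.mem_left
      by_cases hbx : b = x.2
      · have h5 : b + 1 ∉ concatStrings S := fun h => by have := hlt _ h; omega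
        have h6 : ¬ (x.1 ≤ b ∧ b + 1 ≤ x.2) := by omega
        have h7 : x.1 ≤ b ∧ b ≤ x.2 := by omega
        tauto
      · have h6 : (x.1 ≤ b ∧ b ≤ x.2) ↔ (x.1 ≤ b ∧ b + 1 ≤ x.2) := by omega
        tauto

/-- Remove the smallest entry `a`, standardize the rest, and put `a` back. The last conjunct keeps
the induction going: the smallest entry always begins the last string, so `a` can be joined to the
string of `a + 1`. -/
theorem exists_columnStandard {t : List ℤ} {a h : ℤ} (ha : 0 ≤ a) (ht : t.Nodup)
    (hmem : ∀ x, x ∈ t ↔ a ≤ x ∧ x ≤ h) :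
    ∃ S, IsColumnStandard S ∧ TupleEquiv t (concatStrings S) ∧
      (a ≤ h → ∃ S' b, S = S' ++ [(a, b)]) := by
  obtain ⟨n, hn⟩ : ∃ n : ℕ, n = (h + 1 - a).toNat := ⟨_, rfl⟩
  induction n generalizing t a with
  | zero =>
    have : t = [] := List.eq_nil_iff_forall_not_mem.2 fun x hx => by
      have := (hmem x).1 hx
      omega
    subst this
    exact ⟨[], ⟨.nil, by simp⟩, .refl _, fun _ => by omega⟩
  | succ n ih =>
    have hah : a ≤ h := by omega
    obtain ⟨u, v, rfl⟩ := List.append_of_mem ((hmem a).2 ⟨le_rfl, hah⟩)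
    obtain ⟨hau, huv⟩ := List.nodup_cons.1 (List.nodup_middle.1 ht)
    have hmem' : ∀ x, x ∈ u ++ v ↔ a + 1 ≤ x ∧ x ≤ h := by
      intro x
      have h1 := hmem x
      simp only [List.mem_append, List.mem_cons] at h1 hau ⊢
      by_cases hx : x = a
      · subst hx
        exact ⟨fun h => absurd h hau, fun h => by omega⟩
      · constructor
        · intro h
          have := h1.1 (by tauto)
          omega
        · intro h
          have := h1.2 (by omega)
          tauto
    obtain ⟨S, hS, hequiv, hlast⟩ := ih (by omega) huv hmem' (by omega)
    have hcomm : ∀ w : List ℤ, (∀ x ∈ w, a + 1 ≤ x) → a + 1 ∉ w →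
        ∀ x ∈ w, x ≠ a ∧ |x - a| ≠ 1 := by
      intro w hw hw' x hx
      have h1 := hw x hx
      have h2 : x ≠ a + 1 := by rintro rfl; exact hw' hx
      rw [abs_of_pos (by omega)]
      omega
    have hnd : (concatStrings S).Nodup := (hequiv.perm.nodup_iff).1 huv
    have hge : ∀ x ∈ concatStrings S, a + 1 ≤ x := fun x hx =>
      ((hmem' x).1 (hequiv.perm.mem_iff.2 hx)).1
    -- If `a + 1` comes after `a`, then `a` moves to the front, past `u`, and then through all
    -- strings but the last, which it extends to the left.
    by_cases hav : a + 1 ∈ v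
    · obtain ⟨S', b, rfl⟩ := hlast ((hmem' _).1 (List.mem_append_right _ hav)).2
      have hb := hS.2 (a + 1, b) (by simp)
      simp only at hb
      have hau' : a + 1 ∉ u := fun h => (List.nodup_append.1 huv).2.2 _ h _ hav rfl
      have e1 := (tupleEquiv_cons_comm (hcomm u
        (fun x hx => ((hmem' x).1 (List.mem_append_left _ hx)).1) hau')).append [] v
      have e2 := hequiv.append [a] []
      have hcS : concatStrings [(a + 1, b)] = string (a + 1) b := by simp [concatStrings]
      have hcS' : concatStrings [(a, b)] = a :: string (a + 1) b := by
        simp [concatStrings, string_eq_cons (show a ≤ b by omega)]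
      rw [concatStrings_append, hcS] at hnd hge e2
      have e3 := (tupleEquiv_cons_comm (hcomm (concatStrings S')
        (fun x hx => hge x (List.mem_append_left _ hx)) (fun h =>
          (List.nodup_append.1 hnd).2.2 _ h _ (mem_string.2 ⟨le_rfl, hb.2⟩) rfl))).symm.append []
          (string (a + 1) b)
      refine ⟨S' ++ [(a, b)], ⟨?_, ?_⟩, ?_, fun _ => ⟨_, _, rfl⟩⟩
      · have := hS.1
        rw [List.pairwise_append] at this ⊢
        simpa using this
      · intro x hx
        rcases List.mem_append.1 hx with hx | hx
        · exact hS.2 x (List.mem_append_left _ hx)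
        · obtain rfl := List.mem_singleton.1 hx
          exact ⟨ha, by simp only; omega⟩
      · rw [concatStrings_append, hcS']
        simp only [List.append_nil, List.nil_append, List.append_assoc,
          List.cons_append] at e1 e2 e3
        exact (e1.trans e2).trans e3
    -- Otherwise `a` commutes with everything to its right and becomes a last string of its own.
    · have e1 := (tupleEquiv_cons_comm (hcomm v
        (fun x hx => ((hmem' x).1 (List.mem_append_right _ hx)).1) hav)).symm.append u []
      have e2 := hequiv.append [] [a]
      have hca : concatStrings [(a, a)] = [a] := by
        simp [concatStrings, string]
      refine ⟨S ++ [(a, a)], ⟨?_, ?_⟩, ?_, fun _ => ⟨_, _, rfl⟩⟩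
      · rw [List.pairwise_append]
        refine ⟨hS.1, by simp, fun x hx y hy => ?_⟩
        obtain rfl := List.mem_singleton.1 hy
        have := hge _ (mem_concatStrings_of_mem hS hx)
        simp only
        omega
      · intro x hx
        rcases List.mem_append.1 hx with hx | hx
        · exact hS.2 x hx
        · obtain rfl := List.mem_singleton.1 hx
          exact ⟨ha, le_rfl⟩
      · rw [concatStrings_append, hca]
        simp only [List.append_nil, List.nil_append, List.append_assoc] at e1 e2
        exact e1.trans e2

theorem heads_eq {t : List ℤ} {h : ℕ} (ht : IsPermutationOf t (Finset.Icc 0 (h : ℤ))) :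
    heads t = {b | ¬ ColUnit t b} := by
  ext b
  constructor
  · rintro ⟨S, hS, he, hb⟩
    rw [Set.mem_ofPred_eq, he.colUnit_iff]
    exact (hS.mem_heads_iff (he.perm.nodup_iff.1 ht.1) b).1 hb
  · intro hb
    obtain ⟨S, hS, he, -⟩ := exists_columnStandard le_rfl ht.1
      (fun x => (ht.2 x).trans Finset.mem_Icc)
    rw [Set.mem_ofPred_eq, he.colUnit_iff] at hb
    exact ⟨S, hS, he, (hS.mem_heads_iff (he.perm.nodup_iff.1 ht.1) b).2 hb⟩

open Classical in
theorem numHeads_eq {t : List ℤ} {h : ℕ} (ht : IsPermutationOf t (Finset.Icc 0 (h : ℤ))) :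
    numHeads t = ((Finset.Icc 0 (h : ℤ)).filter fun b => ¬ ColUnit t b).card := by
  rw [numHeads, heads_eq ht, ← Set.ncard_coe_finset]
  congr 1
  ext b
  simp only [Set.mem_ofPred_eq, Finset.coe_filter]
  exact ⟨fun hb => ⟨(ht.2 b).1 (by_contra fun h => hb (Or.inl h)), hb⟩, fun hb => hb.2⟩

/-- For `b < h` exactly one of the two orders of `b` and `b + 1` occurs, so `b` is a head of exactly
one of the two tuples. The largest entry `h` is a head of both. -/
theorem numHeads_add_numHeads_reverse {t : List ℤ} {h : ℕ}
    (ht : IsPermutationOf t (Finset.Icc 0 (h : ℤ))) :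
    numHeads t + numHeads t.reverse = h + 2 := by
  classical
  have ht' : IsPermutationOf t.reverse (Finset.Icc 0 (h : ℤ)) :=
    ⟨List.nodup_reverse.2 ht.1, fun x => List.mem_reverse.trans (ht.2 x)⟩
  rw [numHeads_eq ht, numHeads_eq ht', Finset.card_filter, Finset.card_filter,
    ← Finset.sum_add_distrib]
  have key : ∀ b ∈ Finset.Icc 0 (h : ℤ), ((if ¬ ColUnit t b then 1 else 0) +
      (if ¬ ColUnit t.reverse b then 1 else 0) : ℕ) = 1 + if b = h then 1 else 0 := by
    intro b hb
    have hbt := (ht.2 b).2 hb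
    rw [Finset.mem_Icc] at hb
    have e1 : ColUnit t b ↔ Before t b (b + 1) := by simp [ColUnit, hbt]
    have e2 : ColUnit t.reverse b ↔ Before t (b + 1) b := by
      simp [colUnit_reverse, RowUnit, hbt]
    simp only [e1, e2]
    by_cases hbh : b = h
    · have h1 : b + 1 ∉ t := fun h => by
        have := (ht.2 _).1 h
        rw [Finset.mem_Icc] at this
        omega
      rw [if_pos fun h : Before t b (b + 1) => h1 h.mem_right,
        if_pos fun h : Before t (b + 1) b => h1 h.mem_left, if_pos hbh]
    · have h1 : b + 1 ∈ t := (ht.2 _).2 (Finset.mem_Icc.2 (by omega))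
      rw [if_neg hbh]
      rcases Before.total hbt h1 (by omega) with h2 | h2
      · simp [h2, h2.asymm ht.1]
      · simp [h2, h2.asymm ht.1]
  rw [Finset.sum_congr rfl key, Finset.sum_add_distrib, Finset.sum_ite_eq' (Finset.Icc 0 (h : ℤ))]
  simp

/-! ### Pairs of complementary index tuples -/

/-- The relation between the index tuples `q` and `z + k` of a proper generalized Fiedler
pencil. -/
structure IsComplementary (k : ℕ) (q z : List ℤ) : Prop where
  nodup_left : q.Nodup
  nodup_right : z.Nodup
  nonneg_left : ∀ x ∈ q, 0 ≤ x
  nonneg_right : ∀ x ∈ z, 0 ≤ x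
  mem_iff : ∀ x : ℤ, 0 ≤ x → x ≤ k → (x ∈ q ↔ k - x ∉ z)
  lt_left : ∀ x ∈ q, x < k
  lt_right : ∀ x ∈ z, x < k

theorem IsComplementary.symm {k : ℕ} {q z : List ℤ} (h : IsComplementary k q z) :
    IsComplementary k z q where
  nodup_left := h.nodup_right
  nodup_right := h.nodup_left
  nonneg_left := h.nonneg_right
  nonneg_right := h.nonneg_left
  mem_iff x hx hx' := by
    rw [h.mem_iff (k - x) (by omega) (by omega), not_not, sub_sub_cancel]
  lt_left := h.lt_right
  lt_right := h.lt_left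

theorem IsComplementary.reverse {k : ℕ} {q z : List ℤ} (h : IsComplementary k q z) :
    IsComplementary k q.reverse z.reverse where
  nodup_left := List.nodup_reverse.2 h.nodup_left
  nodup_right := List.nodup_reverse.2 h.nodup_right
  nonneg_left := by simpa using h.nonneg_left
  nonneg_right := by simpa using h.nonneg_right
  mem_iff := by simpa using h.mem_iff
  lt_left := by simpa using h.lt_left
  lt_right := by simpa using h.lt_right

theorem IsProperGFPPair.isComplementary {k : ℕ} {q z : List ℤ} (h : IsProperGFPPair k q z) :
    IsComplementary k q (z.map fun x => x + k) := by
  obtain ⟨C₀, C₁, hd, hu, h0, hk, hq, hz⟩ := h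
  have hmq : ∀ x, x ∈ q ↔ x ∈ C₀ := hq.2
  have hmz : ∀ x, x ∈ z ↔ -x ∈ C₁ := fun x => by
    rw [hz.2, Finset.mem_image]
    exact ⟨by rintro ⟨y, hy, rfl⟩; simpa using hy, fun h => ⟨-x, h, by simp⟩⟩
  have hmz' : ∀ x, (x ∈ z.map fun x => x + (k : ℤ)) ↔ k - x ∈ C₁ := fun x => by
    rw [List.mem_map]
    constructor
    · rintro ⟨y, hy, rfl⟩
      simpa using (hmz y).1 hy
    · intro h
      exact ⟨x - k, (hmz _).2 (by simpa using h), by simp⟩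
  have hun : ∀ x, (x ∈ C₀ ∨ x ∈ C₁) ↔ 0 ≤ x ∧ x ≤ k := fun x => by
    rw [← Finset.mem_union, hu, Finset.mem_Icc]
  have hdj : ∀ x, x ∈ C₀ → x ∉ C₁ := fun _ hx => Finset.disjoint_left.1 hd hx
  refine ⟨hq.1, hz.1.map fun a b h => by simpa using h, fun x hx => ?_, fun x hx => ?_,
    fun x hx hx' => ?_, fun x hx => ?_, fun x hx => ?_⟩
  · exact ((hun x).1 (Or.inl ((hmq x).1 hx))).1
  · have := ((hun _).1 (Or.inr ((hmz' x).1 hx))).2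
    omega
  · rw [hmq, hmz', sub_sub_cancel]
    have := (hun x).2 ⟨hx, hx'⟩
    have := hdj x
    tauto
  · have h1 := (hmq x).1 hx
    have := ((hun x).1 (Or.inl h1)).2
    have : x ≠ k := by rintro rfl; exact hdj _ h1 hk
    omega
  · have h1 := (hmz' x).1 hx
    have := ((hun _).1 (Or.inr h1)).1
    have : x ≠ k := by rintro rfl; exact hdj _ h0 (by simpa using h1)
    omega

theorem IsComplementary.zero_mem_left {k : ℕ} {q z : List ℤ} (h : IsComplementary k q z) :
    0 ∈ q :=
  (h.mem_iff 0 le_rfl (by omega)).2 fun h' => by have := h.lt_right _ h'; omega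

theorem mem_map_add_iff {z : List ℤ} {k x : ℤ} :
    (x ∈ z.map fun x => x + k) ↔ x - k ∈ z := by
  rw [List.mem_map]
  exact ⟨by rintro ⟨y, hy, rfl⟩; simpa using hy, fun h => ⟨x - k, h, by simp⟩⟩

theorem before_map_add_iff {z : List ℤ} {k x y : ℤ} :
    Before (z.map fun x => x + k) x y ↔ Before z (x - k) (y - k) := by
  rw [← before_map (add_left_injective k) (t := z)]
  simp

/-- Start from the string consisting of `-k` alone and extend it by its successor as long as that
successor stands to its right. When it does not, everything to the right commutes with the string,
which can then be moved to the end. -/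
theorem exists_isSimplePair {k : ℕ} (hk : 1 ≤ k) {q z : List ℤ}
    (hc : IsComplementary k q (z.map fun x => x + k)) :
    ∃ (qhat : List ℤ) (h : ℕ), IsSimplePair k q z qhat h := by
  have hnd : z.Nodup := hc.nodup_right.of_map _
  have hge : ∀ x ∈ z, -(k : ℤ) ≤ x ∧ x < 0 := fun x hx => by
    have hm : x + k ∈ z.map fun x => x + (k : ℤ) := mem_map_add_iff.2 (by simpa using hx)
    have h1 := hc.nonneg_right _ hm
    have h2 := hc.lt_right _ hm
    omega
  have hqz : ∀ x : ℤ, 0 ≤ x → x ≤ k → (x ∈ q ↔ -x ∉ z) := fun x hx hx' => by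
    rw [hc.mem_iff x hx hx', mem_map_add_iff, show (k : ℤ) - x - k = -x by ring]
  -- collect the indices of the string one after the other
  have main : ∀ (h : ℕ), h < k → ∀ m v : List ℤ,
      TupleEquiv z (m ++ string (-(k : ℤ)) (-(h : ℤ) - 1) ++ v) →
      ∃ (h' : ℕ) (m' : List ℤ), h' < k ∧
        TupleEquiv z (m' ++ string (-(k : ℤ)) (-(h' : ℤ) - 1)) := by
    intro h
    induction h with
    | zero =>
      intro hh m v he
      have hv : v = [] := List.eq_nil_iff_forall_not_mem.2 fun x hx => by
        have h1 := hge x (he.perm.mem_iff.2 (by simp [hx]))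
        have h2 := (List.nodup_append.1 (he.perm.nodup_iff.1 hnd)).2.2 x
          (List.mem_append_right _ (mem_string.2 ⟨h1.1, by push_cast; omega⟩)) x hx
        exact h2 rfl
      subst hv
      exact ⟨0, m, hh, by simpa using he⟩
    | succ h ih =>
      intro hh m v he
      have hstr : ∀ x ∈ v, -(h : ℤ) - 1 ≤ x := fun x hx => by
        by_contra hlt
        have h1 := hge x (he.perm.mem_iff.2 (by simp [hx]))
        have h2 := (List.nodup_append.1 (he.perm.nodup_iff.1 hnd)).2.2 x
          (List.mem_append_right _ (mem_string.2 ⟨h1.1, by push_cast; omega⟩)) x hx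
        exact h2 rfl
      have hcomm : ∀ w : List ℤ, (∀ x ∈ w, x ∈ v) → -(h : ℤ) - 1 ∉ w →
          ∀ x ∈ string (-(k : ℤ)) (-((h + 1 : ℕ) : ℤ) - 1), ∀ a ∈ w,
            x ≠ a ∧ |x - a| ≠ 1 := by
        intro w hw hw' x hx a ha
        have h1 := hstr a (hw a ha)
        have h2 : a ≠ -(h : ℤ) - 1 := by rintro rfl; exact hw' ha
        have h3 := (mem_string.1 hx).2
        push_cast at h3
        rw [abs_of_neg (by omega)]
        omega
      -- The entries between the string and its successor exceed the end of the string by at least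
      -- two, so the string passes them and absorbs the successor.
      by_cases hv : -(h : ℤ) - 1 ∈ v
      · obtain ⟨v₁, v₂, rfl⟩ := List.append_of_mem hv
        have hndv := (List.nodup_append.1 (he.perm.nodup_iff.1 hnd)).2.1
        have hv₁ : -(h : ℤ) - 1 ∉ v₁ := fun h' =>
          (List.nodup_cons.1 (List.nodup_middle.1 hndv)).1 (List.mem_append_left _ h')
        have e := (tupleEquiv_append_comm (hcomm v₁ (fun x hx => by simp [hx]) hv₁)).append m
          ((-(h : ℤ) - 1) :: v₂)
        refine ih (by omega) (m ++ v₁) v₂ (he.trans ?_)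
        have hs : string (-(k : ℤ)) (-(h : ℤ) - 1) =
            string (-(k : ℤ)) (-((h + 1 : ℕ) : ℤ) - 1) ++ [-(h : ℤ) - 1] := by
          have := string_succ (a := -(k : ℤ)) (b := -((h + 1 : ℕ) : ℤ) - 1)
            (by push_cast; omega)
          rwa [show -((h + 1 : ℕ) : ℤ) - 1 + 1 = -(h : ℤ) - 1 by push_cast; ring] at this
        rw [hs]
        simpa only [List.append_nil, List.append_assoc, List.cons_append,
          List.nil_append] using e
      · have e := (tupleEquiv_append_comm (hcomm v (fun x hx => hx) hv)).append m []
        refine ⟨h + 1, m ++ v, hh, he.trans ?_⟩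
        simpa only [List.append_nil, List.append_assoc] using e
  have hkz : -(k : ℤ) ∈ z := by
    by_contra hkz
    have := hc.lt_left _ ((hqz k (by omega) le_rfl).2 hkz)
    omega
  obtain ⟨m, v, hmv⟩ := List.append_of_mem hkz
  obtain ⟨h, m', hh, he⟩ := main (k - 1) (by omega) m v (by
    rw [show -((k - 1 : ℕ) : ℤ) - 1 = -(k : ℤ) by omega, string_eq_cons le_rfl, hmv]
    simpa [string] using TupleEquiv.refl _)
  have hndm := List.nodup_append.1 (he.perm.nodup_iff.1 hnd)
  have hmem : ∀ x, x ∈ z ↔ x ∈ m' ∨ (-(k : ℤ) ≤ x ∧ x ≤ -(h : ℤ) - 1) := fun x => by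
    rw [he.perm.mem_iff, List.mem_append, mem_string]
  have hmemq : ∀ x, x ∈ m'.reverse.map (fun x => -x) ↔ -x ∈ m' := fun x => by
    simp only [List.mem_map, List.mem_reverse]
    exact ⟨by rintro ⟨y, hy, rfl⟩; simpa using hy, fun h => ⟨-x, h, by simp⟩⟩
  refine ⟨_, h, hh, m', he, rfl, ?_, fun x => ?_⟩
  · refine List.nodup_append.2 ⟨?_, hc.nodup_left, fun x hx y hy => ?_⟩
    · exact (List.nodup_reverse.2 hndm.1).map neg_injective
    · rintro rfl
      rw [hmemq] at hx
      have hxz := (hmem _).2 (Or.inl hx)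
      exact (hqz x (hc.nonneg_left x hy) (hc.lt_left x hy).le).1 hy hxz
  · rw [List.mem_append, hmemq, Finset.mem_Icc]
    constructor
    · rintro (hx | hx)
      · have h1 := hge _ ((hmem _).2 (Or.inl hx))
        have h2 : ¬ (-(k : ℤ) ≤ -x ∧ -x ≤ -(h : ℤ) - 1) := fun h' =>
          hndm.2.2 _ hx _ (mem_string.2 h') rfl
        omega
      · have h0 := hc.nonneg_left x hx
        have h1 := hc.lt_left x hx
        have h2 := (hqz x h0 h1.le).1 hx
        rw [hmem] at h2
        omega
    · rintro ⟨h0, h1⟩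
      by_cases hx : x ∈ q
      · exact Or.inr hx
      · rw [hqz x h0 (by omega), not_not, hmem] at hx
        exact Or.inl (hx.resolve_right (by omega))

/-- Reversing and negating `m` preserves the order relation: `-1 - b` precedes `-b` in `m` exactly
when `b` precedes `b + 1` in the image. Indices that `qhat` omits are those of the string in `z`,
where consecutive entries are in increasing order. -/
theorem IsSimplePair.colUnit_iff {k h : ℕ} {q z qhat : List ℤ}
    (hc : IsComplementary k q (z.map fun x => x + k)) (hs : IsSimplePair k q z qhat h)
    {b : ℤ} (hb0 : 0 ≤ b) (hbk : b < k) :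
    ColUnit qhat b ↔ ColUnit q b ∧ ColUnit (z.map fun x => x + (k : ℤ)) (k - 1 - b) := by
  obtain ⟨hh, m, he, rfl, hperm⟩ := hs
  have hnd : z.Nodup := hc.nodup_right.of_map _
  have hndm := List.nodup_append.1 (he.perm.nodup_iff.1 hnd)
  have hmem : ∀ x, x ∈ z ↔ x ∈ m ∨ (-(k : ℤ) ≤ x ∧ x ≤ -(h : ℤ) - 1) := fun x => by
    rw [he.perm.mem_iff, List.mem_append, mem_string]
  have hmemq : ∀ x, x ∈ m.reverse.map (fun x => -x) ↔ -x ∈ m := fun x => by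
    simp only [List.mem_map, List.mem_reverse]
    exact ⟨by rintro ⟨y, hy, rfl⟩; simpa using hy, fun h => ⟨-x, h, by simp⟩⟩
  have hmd : ∀ x, -x ∈ m → x ∉ q := fun x hx hx' =>
    (List.nodup_append.1 hperm.1).2.2 x ((hmemq x).2 hx) x hx' rfl
  have hmq : ∀ x, (-x ∈ m ∨ x ∈ q) ↔ 0 ≤ x ∧ x ≤ h := fun x => by
    rw [← hmemq, ← List.mem_append, hperm.2, Finset.mem_Icc]
  have hbz : Before z (-1 - b) (-b) ↔ Before m (-1 - b) (-b) ∨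
      (-1 - b ∈ m ∧ -(k : ℤ) ≤ -b ∧ -b ≤ -(h : ℤ) - 1) ∨
      (-(k : ℤ) ≤ -1 - b ∧ -b ≤ -(h : ℤ) - 1) := by
    have h1 := before_string_succ (a := -(k : ℤ)) (b := -(h : ℤ) - 1) (x := -1 - b)
    rw [show -1 - b + 1 = -b by ring] at h1
    rw [he.before_iff (by simp), before_append, h1, mem_string]
  have hbq : Before (m.reverse.map (fun x => -x) ++ q) b (b + 1) ↔
      Before m (-1 - b) (-b) ∨ (-b ∈ m ∧ b + 1 ∈ q) ∨ Before q b (b + 1) := by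
    rw [before_append, hmemq]
    have := before_map (f := fun x : ℤ => -x) neg_injective (t := m.reverse) (x := -b)
      (y := -1 - b)
    simp only [neg_neg, before_reverse] at this
    rw [show -(-1 - b) = b + 1 by ring] at this
    rw [this]
  have hcol : ColUnit (z.map fun x => x + (k : ℤ)) (k - 1 - b) ↔
      -1 - b ∉ z ∨ Before z (-1 - b) (-b) := by
    rw [ColUnit, mem_map_add_iff, before_map_add_iff]
    ring_nf
  rw [hcol, hbz, ColUnit, ColUnit, hbq, hmem, List.mem_append, hmemq]
  have hb := hmq b
  have hb' := hmq (b + 1)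
  have hd := hmd b
  have hd' := hmd (b + 1)
  rw [show -(b + 1) = -1 - b by ring] at hb' hd'
  have hm1 : Before m (-1 - b) (-b) → -1 - b ∈ m ∧ -b ∈ m :=
    fun h => ⟨h.mem_left, h.mem_right⟩
  have hm2 : Before q b (b + 1) → b ∈ q ∧ b + 1 ∈ q := fun h => ⟨h.mem_left, h.mem_right⟩
  generalize Before m (-1 - b) (-b) = B₁, Before q b (b + 1) = B₂ at hm1 hm2 ⊢
  clear hbz hbq hcol hmd hmq hmem hmemq hndm hperm he hc hnd
  -- Below `h` the string plays no part. At `h` both sides fail: `h` is the largest entry of `qhat`,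
  -- while either `h` lies in `q` without successor, or `-h` lies in `m` and so precedes `-h - 1`.
  -- Above `h` both sides hold.
  rcases lt_trichotomy b h with hlt | heq | hgt
  · have e3 : ¬ (-(k : ℤ) ≤ -1 - b ∧ -1 - b ≤ -(h : ℤ) - 1) := by omega
    have e4 : ¬ (-(k : ℤ) ≤ -1 - b ∧ -b ≤ -(h : ℤ) - 1) := by omega
    have e5 : ¬ (-(k : ℤ) ≤ -b ∧ -b ≤ -(h : ℤ) - 1) := by omega
    rw [iff_true_right (by omega)] at hb hb'
    simp only [e3, e4, e5, or_false, and_false]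
    by_cases h1 : b ∈ q <;> by_cases h2 : b + 1 ∈ q <;>
      simp_all
  · have e2 : ¬ (0 ≤ b + 1 ∧ b + 1 ≤ h) := by omega
    have e3 : (-(k : ℤ) ≤ -1 - b ∧ -1 - b ≤ -(h : ℤ) - 1) := by omega
    have e4 : ¬ (-(k : ℤ) ≤ -1 - b ∧ -b ≤ -(h : ℤ) - 1) := by omega
    have e5 : ¬ (-(k : ℤ) ≤ -b ∧ -b ≤ -(h : ℤ) - 1) := by omega
    rw [iff_true_right (by omega)] at hb
    rw [iff_false_right e2, not_or] at hb'
    simp only [e3, e5, and_false]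
    tauto
  · have e1 : ¬ (0 ≤ b ∧ b ≤ h) := by omega
    have e4 : (-(k : ℤ) ≤ -1 - b ∧ -b ≤ -(h : ℤ) - 1) := by omega
    rw [iff_false_right e1, not_or] at hb
    simp only [e4, hb.1, hb.2, or_true, and_true, or_false, not_false_iff, true_or, and_self]

/-! ### Ranks of block positions -/

/-- The number of elements of `V` before the position `a`. -/
def rank {k : ℕ} (V : Finset (Fin k)) (a : ℤ) : ℕ := (V.filter fun b : Fin k => (b : ℤ) < a).card

theorem rank_zero {k : ℕ} (V : Finset (Fin k)) : rank V 0 = 0 := by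
  rw [rank, Finset.card_eq_zero, Finset.filter_eq_empty_iff]
  intro b _
  omega

theorem rank_succ {k : ℕ} (V : Finset (Fin k)) (b : Fin k) :
    rank V (b + 1) = rank V b + if b ∈ V then 1 else 0 := by
  classical
  have h : ∀ c : Fin k, (c : ℤ) < (b : ℤ) + 1 ↔ (c : ℤ) < b ∨ c = b := fun c => by
    rw [Fin.ext_iff]; omega
  simp only [rank, h, Finset.filter_or]
  rw [Finset.card_union_of_disjoint]
  · congr 1
    rw [Finset.filter_eq']
    split_ifs <;> simp
  · rw [Finset.disjoint_filter]
    rintro c _ h1 rfl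
    exact lt_irrefl _ h1

theorem rank_congr {k : ℕ} {V : Finset (Fin k)} {a a' : ℤ} (h : a ≤ a')
    (hV : ∀ b ∈ V, a ≤ (b : ℤ) → a' ≤ (b : ℤ)) : rank V a = rank V a' := by
  unfold rank
  congr 1
  refine Finset.filter_congr fun b hb => ⟨fun h1 => by omega, fun h1 => ?_⟩
  by_contra h2
  have := hV b hb (by omega)
  omega

theorem rank_lt_rank {k : ℕ} {V : Finset (Fin k)} {b : Fin k} (hb : b ∈ V) {a : ℤ}
    (h : (b : ℤ) < a) : rank V b < rank V a := by
  refine Finset.card_lt_card ⟨fun c hc => ?_, fun hs => ?_⟩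
  · rw [Finset.mem_filter] at hc ⊢
    exact ⟨hc.1, by omega⟩
  · have := hs (Finset.mem_filter.2 ⟨hb, h⟩)
    rw [Finset.mem_filter] at this
    omega

theorem rank_inj {k : ℕ} {V : Finset (Fin k)} {b c : Fin k} (hb : b ∈ V) (hc : c ∈ V)
    (h : rank V b = rank V c) : b = c := by
  rcases lt_trichotomy b c with h1 | h1 | h1
  · have := rank_lt_rank hb (a := c) (by exact_mod_cast h1)
    omega
  · exact h1
  · have := rank_lt_rank hc (a := b) (by exact_mod_cast h1)
    omega

theorem rank_lt_card {k : ℕ} {V : Finset (Fin k)} {b : Fin k} (hb : b ∈ V) :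
    rank V b < V.card := by
  refine Finset.card_lt_card ⟨Finset.filter_subset _ _, fun hs => ?_⟩
  have := hs hb
  rw [Finset.mem_filter] at this
  omega

theorem rank_card {k : ℕ} (V : Finset (Fin k)) : rank V k = V.card := by
  rw [rank, Finset.filter_true_of_mem]
  intro b _
  omega

theorem rank_add_rank_compl {k : ℕ} (V : Finset (Fin k)) {a : ℕ} (ha : a ≤ k) :
    rank V a + rank Vᶜ a = a := by
  induction a with
  | zero => simp [rank_zero]
  | succ a ih =>
    have h1 := rank_succ V ⟨a, ha⟩
    have h2 := rank_succ Vᶜ ⟨a, ha⟩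
    have h3 := ih (by omega)
    simp only [Finset.mem_compl] at h1 h2
    push_cast
    rw [h1, h2]
    split_ifs <;> omega

theorem rank_orderEmbOfFin {k a : ℕ} {V : Finset (Fin k)} (hV : V.card = a) (i : Fin a) :
    rank V (V.orderEmbOfFin hV i) = i := by
  have : (V.filter fun b : Fin k => (b : ℤ) < (V.orderEmbOfFin hV i : Fin k)) =
      (Finset.univ.filter fun j : Fin a => j < i).map (V.orderEmbOfFin hV).toEmbedding := by
    ext b
    simp only [Finset.mem_filter, Finset.mem_map, Finset.mem_univ, true_and]
    constructor
    · rintro ⟨hb, hlt⟩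
      obtain ⟨j, rfl⟩ : b ∈ Set.range (V.orderEmbOfFin hV) := by
        rw [Finset.range_orderEmbOfFin]; exact hb
      refine ⟨j, ?_, rfl⟩
      have h1 : V.orderEmbOfFin hV j < V.orderEmbOfFin hV i := by exact_mod_cast hlt
      exact (OrderEmbedding.lt_iff_lt _).1 h1
    · rintro ⟨j, hj, rfl⟩
      refine ⟨Finset.orderEmbOfFin_mem _ _ _, ?_⟩
      have := (OrderEmbedding.lt_iff_lt (V.orderEmbOfFin hV)).2 hj
      exact_mod_cast this
  rw [rank, this, Finset.card_map]
  have h2 : (Finset.univ.filter fun j : Fin a => j < i) = Finset.Iio i := by ext; simp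
  rw [h2, Fin.card_Iio]

/-- The permutation that lists first the positions outside `W` and then those in `W`, both in
increasing order. -/
noncomputable def sortPerm {k a b : ℕ} (W : Finset (Fin k)) (hW : Wᶜ.card = a) (hW' : W.card = b)
    (hab : a + b = k) : Equiv.Perm (Fin k) :=
  (finSumFinEquiv.trans (finCongr hab)).symm.trans
    (finSumEquivOfFinset hW (by rwa [compl_compl]))

section SortPerm

variable {k a b : ℕ} (W : Finset (Fin k)) (hW : Wᶜ.card = a) (hW' : W.card = b) (hab : a + b = k)

theorem sortPerm_of_lt {c : Fin k} (hc : (c : ℕ) < a) :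
    sortPerm W hW hW' hab c ∉ W ∧ rank Wᶜ (sortPerm W hW hW' hab c) = c := by
  have h1 : (finSumFinEquiv.trans (finCongr hab)).symm c = Sum.inl ⟨c, hc⟩ := by
    rw [Equiv.symm_apply_eq]
    ext
    simp
  have h2 : sortPerm W hW hW' hab c = Wᶜ.orderEmbOfFin hW ⟨c, hc⟩ := by
    rw [sortPerm, Equiv.trans_apply, h1, finSumEquivOfFinset_inl]
  rw [h2]
  exact ⟨Finset.mem_compl.1 (Finset.orderEmbOfFin_mem _ _ _), rank_orderEmbOfFin hW _⟩

theorem sortPerm_of_le {c : Fin k} (hc : a ≤ (c : ℕ)) :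
    sortPerm W hW hW' hab c ∈ W ∧ a + rank W (sortPerm W hW hW' hab c) = c := by
  have hW'' : Wᶜᶜ.card = b := by rwa [compl_compl]
  have h1 : (finSumFinEquiv.trans (finCongr hab)).symm c = Sum.inr ⟨c - a, by omega⟩ := by
    rw [Equiv.symm_apply_eq]
    ext
    simp [hc]
  have h2 : sortPerm W hW hW' hab c =
      Wᶜᶜ.orderEmbOfFin hW'' ⟨c - a, by omega⟩ := by
    rw [sortPerm, Equiv.trans_apply, h1, finSumEquivOfFinset_inr]
  have h3 := rank_orderEmbOfFin (V := Wᶜᶜ) hW'' ⟨(c : ℕ) - a, by omega⟩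
  have h4 := Finset.orderEmbOfFin_mem Wᶜᶜ hW'' ⟨(c : ℕ) - a, by omega⟩
  rw [← h2] at h3 h4
  simp only [compl_compl] at h3 h4
  exact ⟨h4, by rw [h3]; omega⟩

theorem sortPerm_eq_iff {U : Fin k} (hU : U ∉ W) (c : Fin k) :
    sortPerm W hW hW' hab c = U ↔ (c : ℕ) = rank Wᶜ U := by
  have h0 := rank_lt_card (Finset.mem_compl.2 hU)
  by_cases hc : (c : ℕ) < a
  · obtain ⟨h1, h2⟩ := sortPerm_of_lt W hW hW' hab hc
    constructor
    · rintro rfl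
      exact h2.symm
    · intro h
      exact rank_inj (Finset.mem_compl.2 h1) (Finset.mem_compl.2 hU) (by rw [h2, h])
  · obtain ⟨h1, h2⟩ := sortPerm_of_le W hW hW' hab (not_lt.1 hc)
    constructor
    · rintro rfl
      exact absurd h1 hU
    · intro h
      omega

theorem le_of_sortPerm_mem {c : Fin k} (h : sortPerm W hW hW' hab c ∈ W) : a ≤ (c : ℕ) :=
  not_lt.1 fun hc => (sortPerm_of_lt W hW hW' hab hc).1 h

end SortPerm

/-! ### Wing positions -/

open Classical in
/-- The positions of the block-columns that are unit vectors in both coefficients. -/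
noncomputable def wingCols (k : ℕ) (q z : List ℤ) : Finset (Fin k) :=
  Finset.univ.filter fun j => ColUnit q (k - 1 - (j : ℤ)) ∧ ColUnit z j

/-- The positions of the block-rows that are unit vectors in both coefficients. -/
noncomputable def wingRows (k : ℕ) (q z : List ℤ) : Finset (Fin k) :=
  wingCols k q.reverse z.reverse

theorem mem_wingCols {k : ℕ} {q z : List ℤ} {j : Fin k} :
    j ∈ wingCols k q z ↔ ColUnit q (k - 1 - (j : ℤ)) ∧ ColUnit z j := by
  simp [wingCols]

theorem mem_wingRows {k : ℕ} {q z : List ℤ} {j : Fin k} :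
    j ∈ wingRows k q z ↔ RowUnit q (k - 1 - (j : ℤ)) ∧ RowUnit z j := by
  simp [wingRows, mem_wingCols, colUnit_reverse]

theorem wingRows_reverse {k : ℕ} {q z : List ℤ} :
    wingRows k q.reverse z.reverse = wingCols k q z := by
  simp [wingRows]

theorem isClimb_reverse {t : List ℤ} {s u : ℤ} :
    IsClimb t.reverse (ColUnit t.reverse) s u ↔ IsClimb t (RowUnit t) s u := by
  simp [IsClimb, colUnit_reverse]

namespace IsComplementary

variable {k : ℕ} {q z : List ℤ} (hc : IsComplementary k q z)
include hc

theorem mem_left_iff (a : Fin k) : (k - 1 - (a : ℤ) ∈ q ↔ (a : ℤ) + 1 ∉ z) := by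
  rw [hc.mem_iff _ (by omega) (by omega)]
  ring_nf

theorem succ_mem_left_iff (a : Fin k) : (k - 1 - (a : ℤ) + 1 ∈ q ↔ (a : ℤ) ∉ z) := by
  rw [hc.mem_iff _ (by omega) (by omega)]
  ring_nf

/-- This is the difference, between `a + 1` and `a`, of the count in `rank_add_rank`. -/
theorem not_mem_wings (a : Fin k) :
    (((if a ∈ wingRows k q z then 0 else 1) + (if a ∈ wingCols k q z then 0 else 1) : ℕ) +
      if (a : ℤ) ∈ z then 0 else 1) = 1 + if (a : ℤ) + 1 ∈ z then 0 else 1 := by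
  classical
  have h1 := hc.mem_left_iff a
  have h2 := hc.succ_mem_left_iff a
  have b1 : Before q (k - 1 - (a : ℤ)) (k - 1 - (a : ℤ) + 1) →
    k - 1 - (a : ℤ) ∈ q ∧ k - 1 - (a : ℤ) + 1 ∈ q := fun h => ⟨h.mem_left, h.mem_right⟩
  have b2 : Before q (k - 1 - (a : ℤ) + 1) (k - 1 - (a : ℤ)) →
    k - 1 - (a : ℤ) + 1 ∈ q ∧ k - 1 - (a : ℤ) ∈ q := fun h => ⟨h.mem_left, h.mem_right⟩
  have t1 : k - 1 - (a : ℤ) ∈ q → k - 1 - (a : ℤ) + 1 ∈ q →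
      Before q (k - 1 - (a : ℤ)) (k - 1 - (a : ℤ) + 1) ∨
      Before q (k - 1 - (a : ℤ) + 1) (k - 1 - (a : ℤ)) :=
    fun h h' => Before.total h h' (by omega)
  have t2 : (a : ℤ) ∈ z → (a : ℤ) + 1 ∈ z →
      Before z a ((a : ℤ) + 1) ∨ Before z ((a : ℤ) + 1) a :=
    fun h h' => Before.total h h' (by omega)
  have a1 : Before q (k - 1 - (a : ℤ)) (k - 1 - (a : ℤ) + 1) →
      ¬ Before q (k - 1 - (a : ℤ) + 1) (k - 1 - (a : ℤ)) := fun h => h.asymm hc.nodup_left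
  have a2 : Before z a ((a : ℤ) + 1) → ¬ Before z ((a : ℤ) + 1) a :=
    fun h => h.asymm hc.nodup_right
  simp only [mem_wingRows, mem_wingCols, RowUnit, ColUnit]
  -- If `z` contains both levels, or `q` contains both complementary ones, their order decides which
  -- one of the two wings contains `a`. If only `a` lies in `z`, then `a` is in no wing; if only `a
  -- + 1` does, it is in both, and this case is closed by the simplification.
  by_cases hz : (a : ℤ) ∈ z <;> by_cases hz' : (a : ℤ) + 1 ∈ z <;>
    simp only [hz, hz', not_true_eq_false, not_false_eq_true, iff_true, iff_false] at h1 h2 <;>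
    simp only [hz, hz', h1, h2, not_true_eq_false, not_false_eq_true, true_or, false_or,
      true_and, and_true, if_true, if_false, forall_const] at t1 t2 ⊢
  · by_cases h : Before z a ((a : ℤ) + 1)
    · simp [h, a2 h]
    · simp [h, t2.resolve_left h]
  · have n1 : ¬ Before q (k - 1 - (a : ℤ)) (k - 1 - (a : ℤ) + 1) := fun h => h2 (b1 h).2
    have n2 : ¬ Before q (k - 1 - (a : ℤ) + 1) (k - 1 - (a : ℤ)) := fun h => h2 (b2 h).1
    simp only [n1, n2, false_and, if_false]
  · by_cases h : Before q (k - 1 - (a : ℤ)) (k - 1 - (a : ℤ) + 1)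
    · simp [h, a1 h]
    · simp [h, t1.resolve_left h]

theorem rank_add_rank {a : ℕ} (ha : a ≤ k) :
    rank (wingRows k q z)ᶜ a + rank (wingCols k q z)ᶜ a = a + if (a : ℤ) ∈ z then 0 else 1 := by
  induction a with
  | zero => simp [rank_zero, hc.symm.zero_mem_left]
  | succ a ih =>
    have h1 := rank_succ (wingRows k q z)ᶜ ⟨a, ha⟩
    have h2 := rank_succ (wingCols k q z)ᶜ ⟨a, ha⟩
    have h3 := ih (by omega)
    have h4 := hc.not_mem_wings ⟨a, ha⟩
    simp only [Finset.mem_compl, ite_not] at h1 h2 h4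
    push_cast
    rw [h1, h2]
    omega

theorem rank_compl_wingCols {a : ℕ} (ha : a ≤ k) :
    rank (wingCols k q z)ᶜ a = rank (wingRows k q z) a + if (a : ℤ) ∈ z then 0 else 1 := by
  have h1 := hc.rank_add_rank ha
  have h2 := rank_add_rank_compl (wingRows k q z) ha
  omega

/-- Each level passed has its successor in `q`, so its position is absent from `z` and hence a unit
column there as well. The positions passed are therefore wing columns and do not count; only the end
`U` does. Levels of `q` run against positions, which is why `U` lies before `k - s` and the rank
drops by one. -/
theorem climb_left {s u : ℤ} (h : IsClimb q (ColUnit q) s u) :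
    ∃ U : Fin k, u = k - 1 - (U : ℤ) ∧ U ∉ wingCols k q z ∧
      rank (wingCols k q z)ᶜ U + 1 = rank (wingCols k q z)ᶜ (k - s) := by
  obtain ⟨h1, h2, h3, h4⟩ := h
  have hu0 := hc.nonneg_left u h2
  have huk := hc.lt_left u h2
  obtain ⟨U, hU⟩ : ∃ U : Fin k, u = k - 1 - (U : ℤ) :=
    ⟨⟨(k - 1 - u).toNat, by omega⟩, by simp only; omega⟩
  have hUm : U ∉ wingCols k q z := fun h => h3 (by rw [hU]; exact (mem_wingCols.1 h).1)
  refine ⟨U, hU, hUm, ?_⟩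
  have h5 := rank_succ (wingCols k q z)ᶜ U
  rw [if_pos (Finset.mem_compl.2 hUm)] at h5
  rw [← h5]
  refine rank_congr (by omega) fun b hb hUb => ?_
  by_contra hlt
  refine Finset.mem_compl.1 hb (mem_wingCols.2 ?_)
  have h6 := h4 (k - 1 - (b : ℤ)) (by omega) (by omega)
  refine ⟨h6.2, Or.inl ((hc.succ_mem_left_iff b).1 ?_)⟩
  by_cases h7 : k - 1 - (b : ℤ) + 1 = u
  · rwa [h7]
  · exact (h4 _ (by omega) (by omega)).1

/-- Here levels are positions, so the climb goes to the right, again over wing columns only, and the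
number of body columns before it is unchanged. -/
theorem climb_right {s u : ℤ} (h : IsClimb z (ColUnit z) s u) :
    ∃ U : Fin k, u = (U : ℤ) ∧ U ∉ wingCols k q z ∧
      rank (wingCols k q z)ᶜ U = rank (wingCols k q z)ᶜ s := by
  obtain ⟨h1, h2, h3, h4⟩ := h
  have hu0 := hc.nonneg_right u h2
  have huk := hc.lt_right u h2
  obtain ⟨U, hU⟩ : ∃ U : Fin k, u = (U : ℤ) := ⟨⟨u.toNat, by omega⟩, by simp only; omega⟩
  have hUm : U ∉ wingCols k q z := fun h => h3 (by rw [hU]; exact (mem_wingCols.1 h).2)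
  refine ⟨U, hU, hUm, (rank_congr (by omega) fun b hb hUb => ?_).symm⟩
  by_contra hlt
  refine Finset.mem_compl.1 hb (mem_wingCols.2 ?_)
  have h6 := h4 b (by omega) (by omega)
  refine ⟨Or.inl fun h8 => (hc.mem_left_iff b).1 h8 ?_, h6.2⟩
  by_cases h7 : (b : ℤ) + 1 = u
  · rwa [h7]
  · exact (h4 _ (by omega) (by omega)).1

/-- The positions and ranks of the two nonzero blocks of a wing block-row. -/
theorem exists_wing_positions {a : Fin k} (ha : a ∈ wingRows k q z) {u v : ℤ}
    (hu0 : k - 1 - (a : ℤ) + 1 ∉ q → u = k - 1 - (a : ℤ))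
    (hu1 : k - 1 - (a : ℤ) + 1 ∈ q → IsClimb q (ColUnit q) (k - 1 - (a : ℤ) + 1) u)
    (hv0 : (a : ℤ) + 1 ∉ z → v = a)
    (hv1 : (a : ℤ) + 1 ∈ z → IsClimb z (ColUnit z) ((a : ℤ) + 1) v) :
    ∃ U V : Fin k, u = k - 1 - (U : ℤ) ∧ v = (V : ℤ) ∧
      U ∉ wingCols k q z ∧ V ∉ wingCols k q z ∧
      rank (wingCols k q z)ᶜ U = rank (wingRows k q z) a ∧
      rank (wingCols k q z)ᶜ V = rank (wingRows k q z) a + 1 := by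
  have hr := hc.rank_compl_wingCols (a := a) a.2.le
  have hr' := hc.rank_compl_wingCols (a := a + 1) a.2
  have hs := rank_succ (wingRows k q z) a
  rw [if_pos ha] at hs
  push_cast at hr'
  have h1 := hc.mem_left_iff a
  have h2 := hc.succ_mem_left_iff a
  obtain ⟨hq, hz⟩ := mem_wingRows.1 ha
  have hU : ∃ U : Fin k, u = k - 1 - (U : ℤ) ∧ U ∉ wingCols k q z ∧
      rank (wingCols k q z)ᶜ U = rank (wingRows k q z) a := by
    by_cases hm : k - 1 - (a : ℤ) + 1 ∈ q
    · obtain ⟨U, hU, hUm, hUr⟩ := hc.climb_left (hu1 hm)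
      refine ⟨U, hU, hUm, ?_⟩
      rw [if_neg (h2.1 hm)] at hr
      rw [show (k : ℤ) - (k - 1 - (a : ℤ) + 1) = a by ring, hr] at hUr
      omega
    -- Without a climb the nonzero block is on the diagonal. Position `a` is then a body column,
    -- because a unit row caused by `a + 1` preceding `a` in `z` excludes a unit column.
    · have haz : (a : ℤ) ∈ z := not_not.1 fun h => hm (h2.2 h)
      refine ⟨a, hu0 hm, fun hcol => ?_, by rw [hr, if_pos haz, add_zero]⟩
      have hb := hz.resolve_left (not_not.2 haz)
      exact ((mem_wingCols.1 hcol).2.resolve_left (not_not.2 haz)).asymm hc.nodup_right hb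
  have hV : ∃ V : Fin k, v = (V : ℤ) ∧ V ∉ wingCols k q z ∧
      rank (wingCols k q z)ᶜ V = rank (wingRows k q z) a + 1 := by
    by_cases hm : (a : ℤ) + 1 ∈ z
    · obtain ⟨V, hV, hVm, hVr⟩ := hc.climb_right (hv1 hm)
      refine ⟨V, hV, hVm, ?_⟩
      rw [hVr, hr', if_pos hm, hs, add_zero]
    · have haq : k - 1 - (a : ℤ) ∈ q := h1.2 hm
      have haz : (a : ℤ) ∉ z := fun h => hm ((hz.resolve_left (not_not.2 h)).mem_left)
      refine ⟨a, hv0 hm, fun hcol => ?_, by rw [hr, if_neg haz]⟩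
      have hb := hq.resolve_left (not_not.2 haq)
      exact ((mem_wingCols.1 hcol).1.resolve_left (not_not.2 haq)).asymm hc.nodup_left hb
  obtain ⟨U, hU1, hU2, hU3⟩ := hU
  obtain ⟨V, hV1, hV2, hV3⟩ := hV
  exact ⟨U, V, hU1, hV1, hU2, hV2, hU3, hV3⟩

end IsComplementary

/-- A row that is a unit vector for `q` but not for `z` is a row of the identity for `q`, and its
one lies in a wing column. Such rows contribute nothing to the body of the coefficient. -/
theorem IsComplementary.not_rowUnit_right {k : ℕ} {q z : List ℤ} (hc : IsComplementary k q z)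
    {x : ℤ} (hx0 : 0 ≤ x) (hxk : x < k) (hx : RowUnit q x) (hz : ¬ RowUnit z (k - 1 - x)) :
    x + 1 ∉ q ∧ ColUnit q x ∧ ColUnit z (k - 1 - x) := by
  have h1 := hc.mem_iff x hx0 hxk.le
  have h2 := hc.mem_iff (x + 1) (by omega) (by omega)
  rw [show (k : ℤ) - (x + 1) = k - 1 - x by ring] at h2
  rw [show (k : ℤ) - x = k - 1 - x + 1 by ring] at h1
  rw [RowUnit, not_or, not_not] at hz
  have h3 : x + 1 ∉ q := fun h => h2.1 h hz.1
  have h4 : x ∉ q := hx.elim id fun h => absurd h.mem_left h3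
  refine ⟨h3, Or.inl h4, Or.inr ?_⟩
  exact (Before.total hz.1 (not_not.1 fun h => h4 (h1.2 h)) (by omega)).resolve_right hz.2

/-- This enlarges the range of the one-product description from the nonunit rows and columns of `q`
to all body rows and columns of the pencil. The additional entries vanish by `not_rowUnit_right`,
applied to columns by reversing the tuples. -/
theorem IsComplementary.levelEntry_body {S : Type*} [Ring S] (B : ℤ → S) {k : ℕ} {q z : List ℤ}
    (hc : IsComplementary k q z) :
    ∃ ρ γ : ℤ → ℤ,
      (∀ s ∈ q, IsClimb q (RowUnit q) s (ρ s) ∧ IsClimb q (ColUnit q) s (γ s)) ∧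
      ∀ x y : ℤ, 0 ≤ x → x < k → 0 ≤ y → y < k → ¬ (RowUnit q x ∧ RowUnit z (k - 1 - x)) →
        ¬ (ColUnit q y ∧ ColUnit z (k - 1 - y)) →
        levelEntry B q x y = ∑ s ∈ q.toFinset, if x = ρ s ∧ y = γ s then B s else 0 := by
  obtain ⟨ρ, γ, hργ, hbody⟩ := FiedlerPencil.levelEntry_body B hc.nodup_left hc.nonneg_left
  refine ⟨ρ, γ, hργ, fun x y hx hxk hy hyk hxw hyw => ?_⟩
  by_cases hxq : RowUnit q x
  · obtain ⟨h1, h2, h3⟩ := hc.not_rowUnit_right hx hxk hxq fun h => hxw ⟨hxq, h⟩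
    obtain ⟨u, hu, hu0, -⟩ := levelEntry_row B hc.nodup_left hxq
    have hne : y ≠ x := by
      rintro rfl
      exact hyw ⟨h2, h3⟩
    rw [hu, hu0 h1, if_neg hne, Finset.sum_eq_zero]
    intro s hs
    refine if_neg fun h => (hργ s (List.mem_toFinset.1 hs)).1.2.2.1 ?_
    rwa [← h.1]
  by_cases hyq : ColUnit q y
  · obtain ⟨h1, h2, h3⟩ := hc.reverse.not_rowUnit_right hy hyk (rowUnit_reverse.2 hyq)
      (fun h => hyw ⟨hyq, rowUnit_reverse.1 h⟩)
    rw [colUnit_reverse] at h2 h3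
    obtain ⟨u, hu, hu0, -⟩ := levelEntry_col B hc.nodup_left hy hyq hc.nonneg_left
    have hne : x ≠ y := by
      rintro rfl
      exact hxw ⟨h2, h3⟩
    rw [hu _ hx, hu0 (by simpa using h1), if_neg hne, Finset.sum_eq_zero]
    intro s hs
    refine if_neg fun h => (hργ s (List.mem_toFinset.1 hs)).2.2.2.1 ?_
    rwa [← h.2]
  exact hbody x y hx hy hxq hyq

/-! ### Blocks -/

section Blocks

variable {R : Type*} {k n : ℕ}

theorem block_mul [Semiring R] {a b c m m' : ℕ} (A : Matrix (Fin a × Fin m) (Fin b × Fin n) R)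
    (B : Matrix (Fin b × Fin n) (Fin c × Fin m') R) (i : Fin a) (j : Fin c) :
    block (A * B) i j = ∑ s, block A i s * block B s j := by
  ext x y
  simp [block, Matrix.mul_apply, Matrix.sum_apply, Fintype.sum_prod_type]

theorem block_one [Zero R] [One R] (i j : Fin k) :
    block (1 : Matrix (Fin k × Fin n) (Fin k × Fin n) R) i j = if i = j then 1 else 0 := by
  ext x y
  by_cases h : i = j <;> simp [block, Matrix.one_apply, h]

theorem block_blockPerm [Zero R] [One R] (c : Equiv.Perm (Fin k)) (i j : Fin k) :
    block (blockPerm (R := R) n c) i j = if i = c j then 1 else 0 := rfl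

theorem block_blockTranspose {a b : ℕ} (H : Matrix (Fin a × Fin n) (Fin b × Fin n) R)
    (i : Fin b) (j : Fin a) : block (blockTranspose H) i j = block H j i := rfl

theorem block_blockTranspose_blockPerm_mul [Semiring R] (l : Equiv.Perm (Fin k))
    (K : Matrix (Fin k × Fin n) (Fin k × Fin n) R) (i j : Fin k) :
    block (blockTranspose (blockPerm n l) * K) i j = block K (l i) j := by
  simp [block_mul, block_blockTranspose, block_blockPerm]

theorem block_mul_blockPerm [Semiring R] (r : Equiv.Perm (Fin k))
    (K : Matrix (Fin k × Fin n) (Fin k × Fin n) R) (i j : Fin k) :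
    block (K * blockPerm n r) i j = block K i (r j) := by
  simp [block_mul, block_blockPerm]

end Blocks

/-! ### Entries of products of elementary matrices as block matrices -/

variable {F : Type*} [Field F]

/-- The entries, indexed by levels, of the elementary matrix with index `i`. -/
def elemEntry {S : Type*} [Zero S] [One S] (i : ℤ) (B : S) (x y : ℤ) : S :=
  if x = i ∧ y = i then B
  else if x = i ∧ y = i - 1 then 1
  else if x = i - 1 ∧ y = i then 1
  else if x = i - 1 ∧ y = i - 1 then 0
  else if x = y then 1 else 0

/-- The numbering `lev` is left abstract so that the recursion serves both `q`, with decreasing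
levels, and `z`, with increasing ones. -/
theorem sum_elemEntry_mul {S : Type*} [Ring S] {k : ℕ} {lev : Fin k → ℤ}
    (hinj : Function.Injective lev) (h0 : ∀ r, 0 ≤ lev r)
    (hsurj : ∀ x : ℤ, 0 ≤ x → x < k → ∃ r, lev r = x) {i : ℤ} (hi : 0 ≤ i) (hik : i < k) (B : S)
    (g : ℤ → S) (r : Fin k) :
    ∑ s, elemEntry i B (lev r) (lev s) * g (lev s) =
      if lev r = i then B * g i + (if i = 0 then 0 else g (i - 1))
      else if lev r = i - 1 then g i else g (lev r) := by
  by_cases h1 : lev r = i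
  · rw [if_pos h1]
    have key : ∀ s, elemEntry i B (lev r) (lev s) * g (lev s) =
        (if s = r then B * g i else 0) + (if lev s = i - 1 then g (i - 1) else 0) := by
      intro s
      by_cases h2 : s = r
      · subst h2
        simp only [elemEntry, h1, and_self, if_true]
        rw [if_neg (show i ≠ i - 1 by omega), add_zero]
      · have h3 : lev s ≠ i := fun h => h2 (hinj (by rw [h, h1]))
        by_cases h4 : lev s = i - 1
        · simp [elemEntry, h1, h2, h4]
        · simp [elemEntry, h1, h2, h3, h4, h3.symm]
    simp only [key, Finset.sum_add_distrib, Finset.sum_ite_eq', Finset.mem_univ, if_true]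
    congr 1
    split_ifs with hi0
    · refine Finset.sum_eq_zero fun s _ => if_neg ?_
      have := h0 s
      omega
    · obtain ⟨s, hs⟩ := hsurj (i - 1) (by omega) (by omega)
      rw [Finset.sum_eq_single s (fun b _ hb => if_neg fun h => hb (hinj (by rw [h, hs])))
        (by simp), if_pos hs]
  · rw [if_neg h1]
    obtain ⟨s, hs⟩ : ∃ s, lev s = if lev r = i - 1 then i else lev r := by
      split_ifs with h2
      · exact hsurj i hi hik
      · exact ⟨r, rfl⟩
    rw [Finset.sum_eq_single s, hs]
    · split_ifs with h2
      · simp [elemEntry, h2]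
      · simp [elemEntry, h1, h2]
    · intro b _ hb
      have hb' : lev b ≠ if lev r = i - 1 then i else lev r := fun h => hb (hinj (by rw [h, hs]))
      split_ifs at hb' with h2
      · rw [elemEntry, if_neg (by omega), if_neg (by omega), if_neg (by tauto)]
        split_ifs
        · simp
        · omega
        · simp
      · simp [elemEntry, h1, h2, hb'.symm]
    · simp

theorem block_elemZero {k n : ℕ} (B : Matrix (Fin n) (Fin n) F) (r c : Fin k) :
    block (elemZero k B) r c = if r = c then (if (r : ℕ) + 1 = k then B else 1) else 0 := rfl

theorem block_elemNegTop {k n : ℕ} (B : Matrix (Fin n) (Fin n) F) (r c : Fin k) :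
    block (elemNegTop k B) r c = if r = c then (if (r : ℕ) + 1 = 1 then B else 1) else 0 := rfl

theorem block_elemMiddle {k i n : ℕ} (E₁₁ E₁₂ E₂₁ E₂₂ : Matrix (Fin n) (Fin n) F)
    (r c : Fin k) :
    block (elemMiddle k i E₁₁ E₁₂ E₂₁ E₂₂) r c =
      if (r : ℕ) + 1 = k - i ∧ (c : ℕ) + 1 = k - i then E₁₁
      else if (r : ℕ) + 1 = k - i ∧ (c : ℕ) + 1 = k - i + 1 then E₁₂
      else if (r : ℕ) + 1 = k - i + 1 ∧ (c : ℕ) + 1 = k - i then E₂₁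
      else if (r : ℕ) + 1 = k - i + 1 ∧ (c : ℕ) + 1 = k - i + 1 then E₂₂
      else if r = c then 1 else 0 := rfl

theorem block_elemOf_of_nonneg {k n : ℕ} (P : Matrix (Fin n) (Fin n) F[X]) {i : ℤ} (hi : 0 ≤ i)
    (hik : i < k) (r c : Fin k) :
    block (elemOf k P i) r c = elemEntry i (-coeffMatrix P i.natAbs) (k - 1 - (r : ℤ))
      (k - 1 - (c : ℤ)) := by
  rw [elemOf, if_pos hi, elem]
  by_cases h0 : i = 0
  · subst h0
    rw [if_pos rfl]
    rw [block_elemZero, elemEntry]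
    simp only [Fin.ext_iff]
    split_ifs <;> first | rfl | omega
  · rw [if_neg h0, if_neg (by omega), if_pos (by omega)]
    rw [block_elemMiddle]
    simp only [elemEntry, Fin.ext_iff]
    split_ifs <;> first | rfl | omega

theorem block_elemOf_of_neg {k n : ℕ} (P : Matrix (Fin n) (Fin n) F[X]) {i : ℤ} (hi : i < 0)
    (hik : -(k : ℤ) ≤ i) (r c : Fin k) :
    block (elemOf k P i) r c = elemEntry (i + k) (coeffMatrix P i.natAbs) r c := by
  rw [elemOf, if_neg (by omega), elem, if_neg (by omega)]
  by_cases h0 : i = -(k : ℤ)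
  · subst h0
    rw [if_pos rfl]
    rw [block_elemNegTop, elemEntry]
    simp only [Fin.ext_iff]
    split_ifs <;> first | rfl | omega
  · rw [if_neg h0, if_neg (by omega)]
    rw [block_elemMiddle]
    simp only [elemEntry, Fin.ext_iff]
    split_ifs <;> first | rfl | omega

theorem block_elemProd_of_nonneg {k n : ℕ} (P : Matrix (Fin n) (Fin n) F[X]) {t : List ℤ}
    (ht : ∀ i ∈ t, 0 ≤ i) (htk : ∀ i ∈ t, i < k) (r c : Fin k) :
    block (elemProd k P t) r c = levelEntry (fun i => -coeffMatrix P i.natAbs) t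
      (k - 1 - (r : ℤ)) (k - 1 - (c : ℤ)) := by
  induction t generalizing r with
  | nil =>
    simp only [elemProd, List.map_nil, List.prod_nil, block_one, levelEntry, Fin.ext_iff]
    exact if_congr (by omega) rfl rfl
  | cons i t ih =>
    have ih := ih (fun j hj => ht j (List.mem_cons_of_mem _ hj))
      (fun j hj => htk j (List.mem_cons_of_mem _ hj))
    have hi := ht i (by simp)
    have hik := htk i (by simp)
    rw [elemProd, List.map_cons, List.prod_cons, block_mul, levelEntry]
    change ∑ s, _ * block (elemProd k P t) s c = _
    simp only [ih, block_elemOf_of_nonneg P hi hik]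
    exact sum_elemEntry_mul (lev := fun r : Fin k => k - 1 - (r : ℤ))
      (fun a b h => Fin.ext (by simp only at h; omega)) (fun r => by omega)
      (fun x hx hxk => ⟨⟨(k - 1 - x).toNat, by omega⟩, by simp only; omega⟩) hi hik _
      (fun x => levelEntry (fun i => -coeffMatrix P i.natAbs) t x (k - 1 - (c : ℤ))) r

theorem block_elemProd_of_neg {k n : ℕ} (P : Matrix (Fin n) (Fin n) F[X]) {t : List ℤ}
    (ht : ∀ i ∈ t, i < 0) (htk : ∀ i ∈ t, -(k : ℤ) ≤ i) (r c : Fin k) :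
    block (elemProd k P t) r c = levelEntry (fun i => coeffMatrix P (k - i).natAbs)
      (t.map fun x => x + (k : ℤ)) r c := by
  induction t generalizing r with
  | nil =>
    simp only [elemProd, List.map_nil, List.prod_nil, block_one, levelEntry, Fin.ext_iff]
    exact if_congr (by omega) rfl rfl
  | cons i t ih =>
    have ih := ih (fun j hj => ht j (List.mem_cons_of_mem _ hj))
      (fun j hj => htk j (List.mem_cons_of_mem _ hj))
    have hi := ht i (by simp)
    have hik := htk i (by simp)
    rw [elemProd, List.map_cons, List.prod_cons, block_mul, List.map_cons, levelEntry]
    change ∑ s, _ * block (elemProd k P t) s c = _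
    simp only [ih, block_elemOf_of_neg P hi hik]
    rw [show (k - (i + k : ℤ)).natAbs = i.natAbs by omega]
    exact sum_elemEntry_mul (lev := fun r : Fin k => (r : ℤ))
      (fun a b h => Fin.ext (by simp only at h; omega)) (fun r => by omega)
      (fun x hx hxk => ⟨⟨x.toNat, by omega⟩, by simp only; omega⟩) (by omega) (by omega) _
      (fun x => levelEntry (fun i => coeffMatrix P (k - i).natAbs)
        (t.map fun x => x + (k : ℤ)) x c) r

/-! ### The blocks of a proper generalized Fiedler pencil -/

section Gfp

variable {k n : ℕ} (P : Matrix (Fin n) (Fin n) F[X]) {q z : List ℤ}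
  (hc : IsComplementary k q (z.map fun x => x + (k : ℤ)))
include hc

theorem block_gfp (a c : Fin k) :
    block (gfp k P q z) a c =
      (X : F[X]) • (levelEntry (fun i => coeffMatrix P (k - i).natAbs)
        (z.map fun x => x + (k : ℤ)) a c).map C -
      (levelEntry (fun i => -coeffMatrix P i.natAbs) q (k - 1 - (a : ℤ))
        (k - 1 - (c : ℤ))).map C := by
  rw [← block_elemProd_of_nonneg P hc.nonneg_left hc.lt_left, ← block_elemProd_of_neg P]
  · rfl
  · intro i hi
    have := hc.lt_right (i + k) (mem_map_add_iff.2 (by simpa using hi))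
    omega
  · intro i hi
    have := hc.nonneg_right (i + k) (mem_map_add_iff.2 (by simpa using hi))
    omega

theorem exists_block_row {a : Fin k} (ha : a ∈ wingRows k q (z.map fun x => x + (k : ℤ))) :
    ∃ U V : Fin k, U ∉ wingCols k q (z.map fun x => x + (k : ℤ)) ∧
      V ∉ wingCols k q (z.map fun x => x + (k : ℤ)) ∧
      rank (wingCols k q (z.map fun x => x + (k : ℤ)))ᶜ U =
        rank (wingRows k q (z.map fun x => x + (k : ℤ))) a ∧
      rank (wingCols k q (z.map fun x => x + (k : ℤ)))ᶜ V =
        rank (wingRows k q (z.map fun x => x + (k : ℤ))) a + 1 ∧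
      ∀ c, block (gfp k P q z) a c = (if c = U then -1 else 0) +
        if c = V then (X : F[X]) • 1 else 0 := by
  obtain ⟨h1, h2⟩ := mem_wingRows.1 ha
  obtain ⟨u, hu, hu0, hu1⟩ := levelEntry_row (fun i => -coeffMatrix P i.natAbs) hc.nodup_left h1
  obtain ⟨v, hv, hv0, hv1⟩ := levelEntry_row (fun i => coeffMatrix P (k - i).natAbs)
    hc.nodup_right h2
  obtain ⟨U, V, hU, hV, hUm, hVm, hUr, hVr⟩ := hc.exists_wing_positions ha hu0 hu1 hv0 hv1
  refine ⟨U, V, hUm, hVm, hUr, hVr, fun c => ?_⟩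
  have e1 : k - 1 - (c : ℤ) = u ↔ c = U := by rw [Fin.ext_iff]; omega
  have e2 : (c : ℤ) = v ↔ c = V := by rw [Fin.ext_iff]; omega
  rw [block_gfp P hc, hu, hv, sub_eq_neg_add]
  simp only [e1, e2]
  congr 1
  · split_ifs <;> simp
  · split_ifs <;> simp

theorem exists_block_col {c : Fin k} (hcw : c ∈ wingCols k q (z.map fun x => x + (k : ℤ))) :
    ∃ U V : Fin k, U ∉ wingRows k q (z.map fun x => x + (k : ℤ)) ∧
      V ∉ wingRows k q (z.map fun x => x + (k : ℤ)) ∧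
      rank (wingRows k q (z.map fun x => x + (k : ℤ)))ᶜ U =
        rank (wingCols k q (z.map fun x => x + (k : ℤ))) c ∧
      rank (wingRows k q (z.map fun x => x + (k : ℤ)))ᶜ V =
        rank (wingCols k q (z.map fun x => x + (k : ℤ))) c + 1 ∧
      ∀ a, block (gfp k P q z) a c = (if a = U then -1 else 0) +
        if a = V then (X : F[X]) • 1 else 0 := by
  obtain ⟨h1, h2⟩ := mem_wingCols.1 hcw
  obtain ⟨u, hu, hu0, hu1⟩ := levelEntry_col (fun i => -coeffMatrix P i.natAbs) hc.nodup_left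
    (by omega) h1 hc.nonneg_left
  obtain ⟨v, hv, hv0, hv1⟩ := levelEntry_col (fun i => coeffMatrix P (k - i).natAbs)
    hc.nodup_right (by omega) h2 hc.nonneg_right
  -- Reversing both tuples exchanges rows and columns, so the statement on wing rows applies.
  rw [← wingRows_reverse] at hcw
  obtain ⟨U, V, hU, hV, hUm, hVm, hUr, hVr⟩ := hc.reverse.exists_wing_positions hcw
    (u := u) (v := v) (by simpa using hu0)
    (fun h => isClimb_reverse.2 (hu1 (by simpa using h))) (by simpa using hv0)
    (fun h => isClimb_reverse.2 (hv1 (by simpa using h)))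
  rw [wingRows_reverse] at hUr hVr
  refine ⟨U, V, hUm, hVm, hUr, hVr, fun a => ?_⟩
  have e1 : k - 1 - (a : ℤ) = u ↔ a = U := by rw [Fin.ext_iff]; omega
  have e2 : (a : ℤ) = v ↔ a = V := by rw [Fin.ext_iff]; omega
  rw [block_gfp P hc, hu _ (by omega), hv _ (by omega), sub_eq_neg_add]
  simp only [e1, e2]
  congr 1
  · split_ifs <;> simp
  · split_ifs <;> simp

end Gfp

/-- The positions of the coefficients in the body of the constant term. -/
theorem IsComplementary.exists_body_left {S : Type*} [Ring S] (B : ℤ → S) {k : ℕ} {q z : List ℤ}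
    (hc : IsComplementary k q z) :
    ∃ ρ γ : ℤ → Fin k,
      (∀ s ∈ q, ρ s ∉ wingRows k q z ∧ γ s ∉ wingCols k q z ∧
        rank (wingRows k q z)ᶜ (ρ s) + rank (wingCols k q z)ᶜ (γ s) + s + 1 = k) ∧
      ∀ a c, a ∉ wingRows k q z → c ∉ wingCols k q z →
        levelEntry B q (k - 1 - (a : ℤ)) (k - 1 - (c : ℤ)) =
          ∑ s ∈ q.toFinset, if a = ρ s ∧ c = γ s then B s else 0 := by
  obtain ⟨ρ, γ, hργ, hbody⟩ := hc.levelEntry_body B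
  have h0 : 0 < k := by
    have := hc.lt_left 0 hc.zero_mem_left
    omega
  have hR : ∀ s, ∃ U : Fin k, s ∈ q → ρ s = k - 1 - (U : ℤ) ∧ U ∉ wingRows k q z ∧
      rank (wingRows k q z)ᶜ U + 1 = rank (wingRows k q z)ᶜ (k - s) := fun s => by
    by_cases hs : s ∈ q
    · obtain ⟨U, hU⟩ := hc.reverse.climb_left (isClimb_reverse.2 (hργ s hs).1)
      exact ⟨U, fun _ => hU⟩
    · exact ⟨⟨0, h0⟩, fun h => absurd h hs⟩
  have hC : ∀ s, ∃ U : Fin k, s ∈ q → γ s = k - 1 - (U : ℤ) ∧ U ∉ wingCols k q z ∧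
      rank (wingCols k q z)ᶜ U + 1 = rank (wingCols k q z)ᶜ (k - s) := fun s => by
    by_cases hs : s ∈ q
    · obtain ⟨U, hU⟩ := hc.climb_left (hργ s hs).2
      exact ⟨U, fun _ => hU⟩
    · exact ⟨⟨0, h0⟩, fun h => absurd h hs⟩
  choose R hR using hR
  choose G hG using hC
  refine ⟨R, G, fun s hs => ⟨(hR s hs).2.1, (hG s hs).2.1, ?_⟩, fun a c ha hc' => ?_⟩
  -- Since `k - s` is not in `z`, the count up to `k - s` is `k - s + 1`, and each of the two climbs
  -- loses one.
  · have h1 := (hR s hs).2.2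
    have h2 := (hG s hs).2.2
    have hs0 := hc.nonneg_left s hs
    have hsk := hc.lt_left s hs
    have h3 := hc.rank_add_rank (a := (k - s).toNat) (by omega)
    rw [Int.toNat_of_nonneg (by omega), if_neg ((hc.mem_iff s hs0 hsk.le).1 hs)] at h3
    omega
  · rw [hbody _ _ (by omega) (by omega) (by omega) (by omega)]
    · refine Finset.sum_congr rfl fun s hs => ?_
      have hs := List.mem_toFinset.1 hs
      have h1 := (hR s hs).1
      have h2 := (hG s hs).1
      refine if_congr ?_ rfl rfl
      rw [Fin.ext_iff, Fin.ext_iff]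
      omega
    · rwa [sub_sub_cancel, ← mem_wingRows]
    · rwa [sub_sub_cancel, ← mem_wingCols]

/-- The positions of the coefficients in the body of the leading coefficient. -/
theorem IsComplementary.exists_body_right {S : Type*} [Ring S] (B : ℤ → S) {k : ℕ}
    {q z : List ℤ} (hc : IsComplementary k q z) :
    ∃ ρ γ : ℤ → Fin k,
      (∀ s ∈ z, ρ s ∉ wingRows k q z ∧ γ s ∉ wingCols k q z ∧
        (rank (wingRows k q z)ᶜ (ρ s) + rank (wingCols k q z)ᶜ (γ s) : ℤ) = s) ∧
      ∀ a c, a ∉ wingRows k q z → c ∉ wingCols k q z →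
        levelEntry B z a c = ∑ s ∈ z.toFinset, if a = ρ s ∧ c = γ s then B s else 0 := by
  obtain ⟨ρ, γ, hργ, hbody⟩ := hc.symm.levelEntry_body B
  have h0 : 0 < k := by
    have := hc.lt_left 0 hc.zero_mem_left
    omega
  have hR : ∀ s, ∃ U : Fin k, s ∈ z → ρ s = (U : ℤ) ∧ U ∉ wingRows k q z ∧
      rank (wingRows k q z)ᶜ U = rank (wingRows k q z)ᶜ s := fun s => by
    by_cases hs : s ∈ z
    · obtain ⟨U, hU⟩ := hc.reverse.climb_right (isClimb_reverse.2 (hργ s hs).1)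
      exact ⟨U, fun _ => hU⟩
    · exact ⟨⟨0, h0⟩, fun h => absurd h hs⟩
  have hC : ∀ s, ∃ U : Fin k, s ∈ z → γ s = (U : ℤ) ∧ U ∉ wingCols k q z ∧
      rank (wingCols k q z)ᶜ U = rank (wingCols k q z)ᶜ s := fun s => by
    by_cases hs : s ∈ z
    · obtain ⟨U, hU⟩ := hc.climb_right (hργ s hs).2
      exact ⟨U, fun _ => hU⟩
    · exact ⟨⟨0, h0⟩, fun h => absurd h hs⟩
  choose R hR using hR
  choose G hG using hC
  refine ⟨R, G, fun s hs => ⟨(hR s hs).2.1, (hG s hs).2.1, ?_⟩, fun a c ha hc' => ?_⟩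
  -- Since `s` lies in `z`, the count up to `s` is exactly `s`, and the climbs do not change it.
  · have hs0 := hc.nonneg_right s hs
    have hsk := hc.lt_right s hs
    have h3 := hc.rank_add_rank (a := s.toNat) (by omega)
    rw [Int.toNat_of_nonneg hs0, if_pos hs] at h3
    rw [(hR s hs).2.2, (hG s hs).2.2]
    omega
  · rw [hbody _ _ (by omega) (by omega) (by omega) (by omega)]
    · refine Finset.sum_congr rfl fun s hs => ?_
      have hs := List.mem_toFinset.1 hs
      have h1 := (hR s hs).1
      have h2 := (hG s hs).1
      refine if_congr ?_ rfl rfl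
      rw [Fin.ext_iff, Fin.ext_iff]
      omega
    · rwa [and_comm, ← mem_wingRows]
    · rwa [and_comm, ← mem_wingCols]

/-! ### Sums over the blocks that hold the coefficients -/

theorem sum_sum_ite_eq {ι A : Type*} [AddCommMonoid A] {a b : ℕ} (T : Finset ι) (R G : ι → ℕ)
    (hR : ∀ t ∈ T, R t < a) (hG : ∀ t ∈ T, G t < b) (B : ι → A) (p : ℕ → ℕ → Prop)
    [∀ i j, Decidable (p i j)] (f : Fin a → Fin b → A)
    (hf : ∀ i j, f i j = ∑ t ∈ T, if (i : ℕ) = R t ∧ (j : ℕ) = G t then B t else 0) :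
    ∑ i : Fin a, ∑ j : Fin b, (if p i j then f i j else 0) =
      ∑ t ∈ T, if p (R t) (G t) then B t else 0 := by
  have h1 : ∀ (i : Fin a) (j : Fin b), (if p i j then f i j else 0) =
      ∑ t ∈ T, if p i j then (if (i : ℕ) = R t ∧ (j : ℕ) = G t then B t else 0) else 0 := by
    intro i j
    split_ifs
    · exact hf i j
    · simp
  simp only [h1]
  rw [Finset.sum_congr rfl fun i _ => Finset.sum_comm, Finset.sum_comm]
  refine Finset.sum_congr rfl fun t ht => ?_
  rw [Finset.sum_eq_single ⟨R t, hR t ht⟩, Finset.sum_eq_single ⟨G t, hG t ht⟩]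
  · simp
  · intro j _ hj
    have : (j : ℕ) ≠ G t := fun h => hj (Fin.ext h)
    simp [this]
  · simp
  · intro i _ hi
    have : (i : ℕ) ≠ R t := fun h => hi (Fin.ext h)
    simp [this]
  · simp

/-! ### The SIP after adding one entry -/

theorem sip_iff_getElem? {t : List ℤ} :
    SIP t ↔ ∀ (a b : ℕ) (x : ℤ), a < b → t[a]? = some x → t[b]? = some x →
      ∃ c, a < c ∧ c < b ∧ t[c]? = some (x + 1) := by
  constructor
  · intro h a b x hab ha hb
    obtain ⟨ha', ha⟩ := List.getElem?_eq_some_iff.1 ha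
    obtain ⟨hb', hb⟩ := List.getElem?_eq_some_iff.1 hb
    obtain ⟨c, h1, h2, h3⟩ := h ⟨a, ha'⟩ ⟨b, hb'⟩ hab (by simp [ha, hb])
    refine ⟨c, h1, h2, List.getElem?_eq_some_iff.2 ⟨c.2, ?_⟩⟩
    simpa [ha] using h3
  · intro h a b hab hget
    obtain ⟨c, h1, h2, h3⟩ := h a b (t.get a) hab (by simp) (by rw [hget]; simp)
    obtain ⟨hc, h3⟩ := List.getElem?_eq_some_iff.1 h3
    exact ⟨⟨c, hc⟩, h1, h2, h3⟩

theorem before_iff_getElem? {t : List ℤ} {x y : ℤ} :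
    Before t x y ↔ ∃ i j : ℕ, i < j ∧ t[i]? = some x ∧ t[j]? = some y := by
  induction t with
  | nil => simp [not_before_nil]
  | cons a t ih =>
    rw [before_cons, ih]
    constructor
    · rintro (⟨rfl, h⟩ | ⟨i, j, hij, hi, hj⟩)
      · obtain ⟨j, hj⟩ := List.mem_iff_getElem?.1 h
        exact ⟨0, j + 1, by omega, by simp, by simpa using hj⟩
      · exact ⟨i + 1, j + 1, by omega, by simpa using hi, by simpa using hj⟩
    · rintro ⟨i, j, hij, hi, hj⟩
      obtain ⟨j, rfl⟩ : ∃ j', j = j' + 1 := ⟨j - 1, by omega⟩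
      rw [List.getElem?_cons_succ] at hj
      cases i with
      | zero => exact Or.inl ⟨by simpa using hi.symm, List.mem_of_getElem? hj⟩
      | succ i => exact Or.inr ⟨i, j, by omega, by simpa using hi, hj⟩

theorem getElem?_inj_of_nodup {t : List ℤ} (ht : t.Nodup) {i j : ℕ} {x : ℤ}
    (hi : t[i]? = some x) (hj : t[j]? = some x) : i = j := by
  obtain ⟨hi', hi⟩ := List.getElem?_eq_some_iff.1 hi
  obtain ⟨hj', hj⟩ := List.getElem?_eq_some_iff.1 hj
  exact (ht.getElem_inj_iff).1 (hi.trans hj.symm)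

/-- The only possible repetition is between the new entry and an earlier `y`, and the required infix
is then a `y + 1` after that `y`. -/
theorem sip_append_singleton {t : List ℤ} (ht : t.Nodup) (y : ℤ) :
    SIP (t ++ [y]) ↔ ColUnit t y := by
  rw [sip_iff_getElem?, ColUnit]
  constructor
  · intro h
    refine or_iff_not_imp_left.2 fun hy => ?_
    obtain ⟨i, hi⟩ := List.mem_iff_getElem?.1 (not_not.1 hy)
    obtain ⟨hi', -⟩ := List.getElem?_eq_some_iff.1 hi
    obtain ⟨c, h1, h2, h3⟩ := h i t.length y hi' (by rwa [List.getElem?_append_left hi'])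
      (by simp)
    rw [List.getElem?_append_left h2] at h3
    exact before_iff_getElem?.2 ⟨i, c, h1, hi, h3⟩
  · intro h a b x hab ha hb
    have hb' : b < t.length + 1 := by
      simpa using (List.getElem?_eq_some_iff.1 hb).1
    rw [List.getElem?_append_left (by omega)] at ha
    by_cases hbt : b < t.length
    · rw [List.getElem?_append_left hbt] at hb
      have := getElem?_inj_of_nodup ht ha hb
      omega
    · obtain rfl : b = t.length := by omega
      obtain rfl : y = x := by simpa using hb
      obtain ⟨i, j, hij, hi, hj⟩ := before_iff_getElem?.1
        (h.resolve_left (not_not.2 (List.mem_of_getElem? ha)))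
      have hj' := (List.getElem?_eq_some_iff.1 hj).1
      obtain rfl := getElem?_inj_of_nodup ht ha hi
      exact ⟨j, hij, hj', by rwa [List.getElem?_append_left hj']⟩

theorem sip_cons {t : List ℤ} (ht : t.Nodup) (y : ℤ) : SIP (y :: t) ↔ RowUnit t y := by
  rw [sip_iff_getElem?, RowUnit]
  constructor
  · intro h
    refine or_iff_not_imp_left.2 fun hy => ?_
    obtain ⟨i, hi⟩ := List.mem_iff_getElem?.1 (not_not.1 hy)
    obtain ⟨c, h1, h2, h3⟩ := h 0 (i + 1) y (by omega) (by simp) (by simpa using hi)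
    obtain ⟨c, rfl⟩ : ∃ c', c = c' + 1 := ⟨c - 1, by omega⟩
    exact before_iff_getElem?.2 ⟨c, i, by omega, by simpa using h3, hi⟩
  · intro h a b x hab ha hb
    obtain ⟨b, rfl⟩ : ∃ b', b = b' + 1 := ⟨b - 1, by omega⟩
    rw [List.getElem?_cons_succ] at hb
    cases a with
    | zero =>
      obtain rfl : y = x := by simpa using ha
      obtain ⟨i, j, hij, hi, hj⟩ := before_iff_getElem?.1
        (h.resolve_left (not_not.2 (List.mem_of_getElem? hb)))
      obtain rfl := getElem?_inj_of_nodup ht hb hj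
      exact ⟨i + 1, by omega, by omega, by simpa using hi⟩
    | succ a =>
      rw [List.getElem?_cons_succ] at ha
      have := getElem?_inj_of_nodup ht ha hb
      omega

/-- The map from a position to its level `k - 1 - j` carries the body columns onto the heads of
`qhat`. -/
theorem IsSimplePair.numHeads_eq_card {k h : ℕ} {q z qhat : List ℤ}
    (hc : IsComplementary k q (z.map fun x => x + k)) (hs : IsSimplePair k q z qhat h) :
    numHeads qhat = (wingCols k q (z.map fun x => x + (k : ℤ)))ᶜ.card := by
  classical
  have hperm : IsPermutationOf qhat (Finset.Icc 0 (h : ℤ)) := hs.2.choose_spec.2.2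
  rw [numHeads_eq hperm]
  symm
  refine Finset.card_bij (fun j _ => k - 1 - (j : ℤ)) (fun j hj => ?_)
    (fun i _ j _ hij => Fin.ext (by omega)) (fun b hb => ?_)
  · rw [Finset.mem_compl, mem_wingCols] at hj
    have hcol := hs.colUnit_iff hc (b := k - 1 - (j : ℤ)) (by omega) (by omega)
    rw [sub_sub_cancel] at hcol
    rw [← hcol] at hj
    rw [Finset.mem_filter]
    exact ⟨(hperm.2 _).1 (by_contra fun h => hj (Or.inl h)), hj⟩
  · rw [Finset.mem_filter, Finset.mem_Icc] at hb
    have hh := hs.1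
    refine ⟨⟨(k - 1 - b).toNat, by omega⟩, ?_, by simp only; omega⟩
    rw [Finset.mem_compl, mem_wingCols]
    have hcol := hs.colUnit_iff hc (b := b) (by omega) (by omega)
    have e : (((k - 1 - b).toNat : ℕ) : ℤ) = k - 1 - b := by omega
    simp only [e, sub_sub_cancel]
    rw [← hcol]
    exact hb.2

theorem coe_blockSplit_inl {a b k n : ℕ} (hab : a + b = k) (x : Fin a × Fin n) :
    blockSplit n hab (Sum.inl x) = (⟨x.1, by omega⟩, x.2) := rfl

theorem coe_blockSplit_inr {a b k n : ℕ} (hab : a + b = k) (x : Fin b × Fin n) :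
    blockSplit n hab (Sum.inr x) = (⟨a + x.1, by omega⟩, x.2) := rfl

/-! ### The body and the AS condition -/

section Main

variable {F : Type*} [Field F] {n k : ℕ} (P : Matrix (Fin n) (Fin n) F[X]) {q z : List ℤ}

theorem natDegree_gfp_le (x y : Fin k × Fin n) : (gfp k P q z x y).natDegree ≤ 1 := by
  change ((X : F[X]) * C (elemProd k P z x y) - C (elemProd k P q x y)).natDegree ≤ 1
  compute_degree

/-- The body of the block Kronecker pencil obtained from a proper generalized Fiedler pencil. -/
noncomputable def body (P : Matrix (Fin n) (Fin n) F[X]) (q z : List ℤ) {p' q' : ℕ}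
    (hpq : p' + q' + 1 = k) (l r : Equiv.Perm (Fin k)) :
    Matrix (Fin (q' + 1) × Fin n) (Fin (p' + 1) × Fin n) F[X] :=
  Matrix.of fun x y => gfp k P q z (l ⟨x.1, by omega⟩, x.2) (r ⟨y.1, by omega⟩, y.2)

variable (hc : IsComplementary k q (z.map fun x => x + (k : ℤ))) {p' q' : ℕ}
  (hpq : p' + q' + 1 = k) (l r : Equiv.Perm (Fin k))
include hc

theorem coeffMatrix_one_block_gfp (a c : Fin k) :
    coeffMatrix (block (gfp k P q z) a c) 1 =
      levelEntry (fun i => coeffMatrix P (k - i).natAbs) (z.map fun x => x + (k : ℤ)) a c := by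
  rw [block_gfp P hc]
  ext i j
  simp [coeffMatrix, coeff_C]

theorem coeffMatrix_zero_block_gfp (a c : Fin k) :
    coeffMatrix (block (gfp k P q z) a c) 0 =
      -levelEntry (fun i => -coeffMatrix P i.natAbs) q (k - 1 - (a : ℤ)) (k - 1 - (c : ℤ)) := by
  rw [block_gfp P hc]
  ext i j
  simp [coeffMatrix]

/-- After sorting, a body block has its two ranks as coordinates, so the rank sums of
`exists_body_left` and `exists_body_right` say on which antidiagonal each coefficient lies. -/
theorem asCondition_body
    (hl : ∀ i : Fin k, (i : ℕ) < q' + 1 → l i ∉ wingRows k q (z.map fun x => x + (k : ℤ)))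
    (hr : ∀ i : Fin k, (i : ℕ) < p' + 1 → r i ∉ wingCols k q (z.map fun x => x + (k : ℤ)))
    (hl' : ∀ U ∉ wingRows k q (z.map fun x => x + (k : ℤ)), ∀ i,
      l i = U ↔ (i : ℕ) = rank (wingRows k q (z.map fun x => x + (k : ℤ)))ᶜ U)
    (hr' : ∀ U ∉ wingCols k q (z.map fun x => x + (k : ℤ)), ∀ i,
      r i = U ↔ (i : ℕ) = rank (wingCols k q (z.map fun x => x + (k : ℤ)))ᶜ U)
    (hcl : (wingRows k q (z.map fun x => x + (k : ℤ)))ᶜ.card = q' + 1)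
    (hcr : (wingCols k q (z.map fun x => x + (k : ℤ)))ᶜ.card = p' + 1) :
    ASCondition (body P q z hpq l r) P := by
  intro s hs
  obtain ⟨ρ, γ, h1, h2⟩ := hc.exists_body_left fun i => -coeffMatrix P i.natAbs
  obtain ⟨ρ', γ', h1', h2'⟩ := hc.exists_body_right fun i => coeffMatrix P (k - i).natAbs
  have lt1 : ∀ U ∉ wingRows k q (z.map fun x => x + (k : ℤ)),
      rank (wingRows k q (z.map fun x => x + (k : ℤ)))ᶜ U < q' + 1 := fun U hU => by
    rw [← hcl]; exact rank_lt_card (Finset.mem_compl.2 hU)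
  have lt2 : ∀ U ∉ wingCols k q (z.map fun x => x + (k : ℤ)),
      rank (wingCols k q (z.map fun x => x + (k : ℤ)))ᶜ U < p' + 1 := fun U hU => by
    rw [← hcr]; exact rank_lt_card (Finset.mem_compl.2 hU)
  have e1 := sum_sum_ite_eq (a := q' + 1) (b := p' + 1) (z.map fun x => x + (k : ℤ)).toFinset
    (fun t => rank (wingRows k q (z.map fun x => x + (k : ℤ)))ᶜ (ρ' t))
    (fun t => rank (wingCols k q (z.map fun x => x + (k : ℤ)))ᶜ (γ' t))
    (fun t ht => lt1 _ (h1' t (List.mem_toFinset.1 ht)).1)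
    (fun t ht => lt2 _ (h1' t (List.mem_toFinset.1 ht)).2.1)
    (fun i => coeffMatrix P (k - i).natAbs) (fun i j => (i + 1) + (j + 1) + s = (p' + q' + 1) + 2)
    (fun i j => block (coeffMatrix (body P q z hpq l r) 1) i j) (fun i j => by
      refine (coeffMatrix_one_block_gfp P hc (l ⟨i, by omega⟩) (r ⟨j, by omega⟩)).trans ?_
      rw [h2' _ _ (hl _ i.2) (hr _ j.2)]
      refine Finset.sum_congr rfl fun t ht => ?_
      obtain ⟨h3, h4, -⟩ := h1' t (List.mem_toFinset.1 ht)
      exact if_congr (and_congr (hl' _ h3 _) (hr' _ h4 _)) rfl rfl)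
  have e2 := sum_sum_ite_eq (a := q' + 1) (b := p' + 1) q.toFinset
    (fun t => rank (wingRows k q (z.map fun x => x + (k : ℤ)))ᶜ (ρ t))
    (fun t => rank (wingCols k q (z.map fun x => x + (k : ℤ)))ᶜ (γ t))
    (fun t ht => lt1 _ (h1 t (List.mem_toFinset.1 ht)).1)
    (fun t ht => lt2 _ (h1 t (List.mem_toFinset.1 ht)).2.1)
    (fun i => coeffMatrix P i.natAbs) (fun i j => (i + 1) + (j + 1) + s = (p' + q' + 1) + 1)
    (fun i j => block (coeffMatrix (body P q z hpq l r) 0) i j) (fun i j => by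
      refine (coeffMatrix_zero_block_gfp P hc (l ⟨i, by omega⟩) (r ⟨j, by omega⟩)).trans ?_
      rw [h2 _ _ (hl _ i.2) (hr _ j.2), ← Finset.sum_neg_distrib]
      refine Finset.sum_congr rfl fun t ht => ?_
      obtain ⟨h3, h4, -⟩ := h1 t (List.mem_toFinset.1 ht)
      rw [apply_ite Neg.neg, neg_neg, neg_zero]
      exact if_congr (and_congr (hl' _ h3 _) (hr' _ h4 _)) rfl rfl)
  rw [antidiagSum, e1, e2]
  have e3 : ∀ t ∈ (z.map fun x => x + (k : ℤ)).toFinset,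
      (if (rank (wingRows k q (z.map fun x => x + (k : ℤ)))ᶜ (ρ' t) + 1) +
        (rank (wingCols k q (z.map fun x => x + (k : ℤ)))ᶜ (γ' t) + 1) + s = (p' + q' + 1) + 2
        then coeffMatrix P (k - t).natAbs else 0) =
      if t = k - s then coeffMatrix P s else 0 := fun t ht => by
    have h3 := (h1' t (List.mem_toFinset.1 ht)).2.2
    by_cases h4 : t = k - s
    · rw [if_pos (by omega), if_pos h4, show ((k : ℤ) - t).natAbs = s by omega]
    · rw [if_neg (by omega), if_neg h4]
  have e4 : ∀ t ∈ q.toFinset,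
      (if (rank (wingRows k q (z.map fun x => x + (k : ℤ)))ᶜ (ρ t) + 1) +
        (rank (wingCols k q (z.map fun x => x + (k : ℤ)))ᶜ (γ t) + 1) + s = (p' + q' + 1) + 1
        then coeffMatrix P t.natAbs else 0) =
      if t = s then coeffMatrix P s else 0 := fun t ht => by
    have h3 := (h1 t (List.mem_toFinset.1 ht)).2.2
    by_cases h4 : t = s
    · rw [if_pos (by omega), if_pos h4, h4, Int.natAbs_natCast]
    · rw [if_neg (by omega), if_neg h4]
  rw [Finset.sum_congr rfl e3, Finset.sum_congr rfl e4, Finset.sum_ite_eq', Finset.sum_ite_eq']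
  simp only [List.mem_toFinset]
  -- Exactly one of the two coefficients of the pencil contains the block `A_s`.
  have h5 := hc.mem_iff s (by omega) (by omega)
  by_cases h6 : (s : ℤ) ∈ q
  · rw [if_neg (h5.1 h6), if_pos h6, zero_add]
  · rw [if_pos (not_not.1 fun h => h6 (h5.2 h)), if_neg h6, add_zero]

end Main

end FiedlerPencil

/-! ### Assembly of the block Kronecker form -/

theorem theorem7p1 {F : Type*} [Field F] {n k : ℕ} (hk : 1 ≤ k)
    (P : Matrix (Fin n) (Fin n) F[X]) (hP : HasGrade P k)
    (q z : List ℤ) (hqz : IsProperGFPPair k q z) :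
    (∃ (qhat : List ℤ) (h : ℕ), IsSimplePair k q z qhat h) ∧
    ∀ (qhat : List ℤ) (h : ℕ), IsSimplePair k q z qhat h →
      ∃ p' q' : ℕ,
        (p' : ℤ) = (numHeads qhat : ℤ) - 1 ∧
        (q' : ℤ) = (numHeads qhat.reverse : ℤ) + (k : ℤ) - (h : ℤ) - 2 ∧
        ∃ (hpq : p' + q' + 1 = k) (l r : Equiv.Perm (Fin k))
          (M : Matrix (Fin (q' + 1) × Fin n) (Fin (p' + 1) × Fin n) F[X]),
          IsBlockKroneckerWithBody p' q' hpq
            (blockTranspose (blockPerm n l) * gfp k P q z * blockPerm n r) M ∧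
          ASCondition M P ∧
          -- wing block-columns
          (∀ j ∈ wingColPositions r p', ∃ i : ℕ, 1 ≤ i ∧ i ≤ q' ∧
            blockCol (blockTranspose (blockPerm n l) * gfp k P q z) j =
              -unitCol F[X] k n i + (X : F[X]) • unitCol F[X] k n (i + 1)) ∧
          wingColPositions r p' =
            {j : Fin k | SIP (q ++ [(k : ℤ) - ((j : ℤ) + 1)]) ∧
              SIP (z.map (fun x => x + (k : ℤ)) ++ [((j : ℤ) + 1) - 1])} ∧
          -- wing block-rows
          (∀ j ∈ wingRowPositions l q', ∃ i : ℕ, 1 ≤ i ∧ i ≤ p' ∧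
            blockRow (gfp k P q z * blockPerm n r) j =
              -unitRow F[X] k n i + (X : F[X]) • unitRow F[X] k n (i + 1)) ∧
          wingRowPositions l q' =
            {j : Fin k | SIP ([(k : ℤ) - ((j : ℤ) + 1)] ++ q) ∧
              SIP ([((j : ℤ) + 1) - 1] ++ z.map (fun x => x + (k : ℤ)))} := by
  have hc := hqz.isComplementary
  refine ⟨exists_isSimplePair hk hc, fun qhat h hs => ?_⟩
  have hheads := hs.numHeads_eq_card hc
  have hsum := numHeads_add_numHeads_reverse hs.2.choose_spec.2.2
  -- Counting all positions gives `k + 1` body rows and columns together, as `k` is not in the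
  -- shifted `z`. Hence there are as many body rows as wing columns plus one, and vice versa.
  have hcards := hc.rank_add_rank le_rfl
  rw [if_neg fun h => lt_irrefl _ (hc.lt_right _ h), rank_card, rank_card] at hcards
  have hX := (wingRows k q (z.map fun x => x + (k : ℤ))).card_add_card_compl
  have hY := (wingCols k q (z.map fun x => x + (k : ℤ))).card_add_card_compl
  rw [Fintype.card_fin] at hX hY
  obtain ⟨p', hp'⟩ : ∃ p', p' = (wingRows k q (z.map fun x => x + (k : ℤ))).card := ⟨_, rfl⟩
  obtain ⟨q', hq'⟩ : ∃ q', q' = (wingCols k q (z.map fun x => x + (k : ℤ))).card := ⟨_, rfl⟩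
  have hh := hs.1
  have hXc : (wingRows k q (z.map fun x => x + (k : ℤ)))ᶜ.card = q' + 1 := by omega
  have hYc : (wingCols k q (z.map fun x => x + (k : ℤ)))ᶜ.card = p' + 1 := by omega
  have hpq : p' + q' + 1 = k := by omega
  have hl := @sortPerm_of_lt k (q' + 1) p' _ hXc hp'.symm (by omega)
  have hl2 := @sortPerm_of_le k (q' + 1) p' _ hXc hp'.symm (by omega)
  have hl3 := @sortPerm_eq_iff k (q' + 1) p' _ hXc hp'.symm (by omega)
  have hl4 := @le_of_sortPerm_mem k (q' + 1) p' _ hXc hp'.symm (by omega)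
  have hr := @sortPerm_of_lt k (p' + 1) q' _ hYc hq'.symm (by omega)
  have hr2 := @sortPerm_of_le k (p' + 1) q' _ hYc hq'.symm (by omega)
  have hr3 := @sortPerm_eq_iff k (p' + 1) q' _ hYc hq'.symm (by omega)
  have hr4 := @le_of_sortPerm_mem k (p' + 1) q' _ hYc hq'.symm (by omega)
  -- From here on only the four recorded properties of each permutation are used.
  generalize sortPerm _ hXc hp'.symm _ = l at hl hl2 hl3 hl4
  generalize sortPerm _ hYc hq'.symm _ = r at hr hr2 hr3 hr4
  have hcol : ∀ c ∈ wingCols k q (z.map fun x => x + (k : ℤ)), ∀ a,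
      block (gfp k P q z) (l a) c =
        (if (a : ℕ) = rank (wingCols k q (z.map fun x => x + (k : ℤ))) c then -1 else 0) +
        if (a : ℕ) = rank (wingCols k q (z.map fun x => x + (k : ℤ))) c + 1
          then (X : F[X]) • 1 else 0 := by
    intro c hcw a
    obtain ⟨U, V, hU, hV, hUr, hVr, hblock⟩ := exists_block_col P hc hcw
    rw [hblock]
    simp only [hl3 hU, hl3 hV, hUr, hVr]
  have hrow : ∀ a ∈ wingRows k q (z.map fun x => x + (k : ℤ)), ∀ c,
      block (gfp k P q z) a (r c) =
        (if (c : ℕ) = rank (wingRows k q (z.map fun x => x + (k : ℤ))) a then -1 else 0) +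
        if (c : ℕ) = rank (wingRows k q (z.map fun x => x + (k : ℤ))) a + 1
          then (X : F[X]) • 1 else 0 := by
    intro a haw c
    obtain ⟨U, V, hU, hV, hUr, hVr, hblock⟩ := exists_block_row P hc haw
    rw [hblock]
    simp only [hr3 hU, hr3 hV, hUr, hVr]
  have hwc : ∀ j, j ∈ wingColPositions r p' ↔
      j ∈ wingCols k q (z.map fun x => x + (k : ℤ)) := by
    intro j
    constructor
    · rintro ⟨c, hc1, rfl⟩
      exact (hr2 (by omega)).1
    · intro hj
      refine ⟨r.symm j, ?_, r.apply_symm_apply j⟩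
      have := hr4 (c := r.symm j) (by rwa [r.apply_symm_apply])
      omega
  have hwr : ∀ j, j ∈ wingRowPositions l q' ↔
      j ∈ wingRows k q (z.map fun x => x + (k : ℤ)) := by
    intro j
    constructor
    · rintro ⟨c, hc1, rfl⟩
      exact (hl2 (by omega)).1
    · intro hj
      refine ⟨l.symm j, ?_, l.apply_symm_apply j⟩
      have := hl4 (c := l.symm j) (by rwa [l.apply_symm_apply])
      omega
  have hblock : ∀ i j, block (blockTranspose (blockPerm n l) * gfp k P q z * blockPerm n r) i j =
      block (gfp k P q z) (l i) (r j) := fun i j => by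
    rw [block_mul_blockPerm, block_blockTranspose_blockPerm_mul]
  refine ⟨p', q', by omega, by omega, hpq, l, r, body P q z hpq l r, ⟨fun i j =>
    natDegree_gfp_le P _ _, ?_⟩, asCondition_body P hc hpq l r (fun i hi => (hl hi).1)
      (fun i hi => (hr hi).1) (fun _ hU => hl3 hU)
      (fun _ hU => hr3 hU) hXc hYc, ?_, ?_, ?_, ?_⟩
  · have hentry : ∀ i j a b,
        (blockTranspose (blockPerm n l) * gfp k P q z * blockPerm n r :
          Matrix (Fin k × Fin n) (Fin k × Fin n) F[X]) (i, a) (j, b) =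
          block (gfp k P q z) (l i) (r j) a b := fun i j a b => by
      rw [← hblock]
      rfl
    rw [← Equiv.symm_apply_eq, Matrix.reindex_symm]
    ext x y
    rw [Matrix.reindex_apply, Matrix.submatrix_apply, Equiv.symm_symm, Equiv.symm_symm]
    rcases x with ⟨i, a⟩ | ⟨i, a⟩ <;> rcases y with ⟨j, b⟩ | ⟨j, b⟩
    · rw [coe_blockSplit_inl, coe_blockSplit_inl, hentry]
      rfl
    · rw [coe_blockSplit_inl, coe_blockSplit_inr, hentry]
      obtain ⟨h1, h2⟩ := hr2 (c := ⟨p' + 1 + j, by omega⟩) (by simp)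
      rw [hcol _ h1]
      simp only [add_right_inj] at h2
      rw [h2, blockKronecker, Matrix.fromBlocks_apply₁₂, Matrix.kronecker_apply,
        Matrix.transpose_apply, pencilL, Matrix.of_apply]
      split_ifs <;> first | omega | simp
    · rw [coe_blockSplit_inr, coe_blockSplit_inl, hentry]
      obtain ⟨h1, h2⟩ := hl2 (c := ⟨q' + 1 + i, by omega⟩) (by simp)
      rw [hrow _ h1]
      simp only [add_right_inj] at h2
      rw [h2, blockKronecker, Matrix.fromBlocks_apply₂₁, Matrix.kronecker_apply, pencilL,
        Matrix.of_apply]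
      split_ifs <;> first | omega | simp
    · rw [coe_blockSplit_inr, coe_blockSplit_inr, hentry]
      obtain ⟨h1, h2⟩ := hl2 (c := ⟨q' + 1 + i, by omega⟩) (by simp)
      rw [hrow _ h1]
      simp only [add_right_inj] at h2
      -- A wing row has its nonzero blocks in the columns `i` and `i + 1` with `i < p'`, whereas the
      -- wing columns start at `p' + 1`.
      rw [h2, if_neg (by simp only; omega), if_neg (by simp only; omega)]
      simp [blockKronecker]
  · intro j hj
    rw [hwc] at hj
    have hlt := rank_lt_card hj
    refine ⟨rank (wingCols k q (z.map fun x => x + (k : ℤ))) j + 1, by omega, by omega, ?_⟩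
    ext x b
    have h1 : blockCol (blockTranspose (blockPerm n l) * gfp k P q z) j x b =
        block (blockTranspose (blockPerm n l) * gfp k P q z) x.1 j x.2 b := rfl
    rw [h1, block_blockTranspose_blockPerm_mul, hcol j hj]
    simp only [unitCol, Matrix.add_apply, Matrix.neg_apply, Matrix.smul_apply, Matrix.of_apply,
      add_left_inj]
    by_cases h2 : (x.1 : ℕ) = rank (wingCols k q (z.map fun x => x + (k : ℤ))) j
    · simp [h2, Matrix.one_apply]
    · by_cases h3 : (x.1 : ℕ) = rank (wingCols k q (z.map fun x => x + (k : ℤ))) j + 1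
      · simp [h3, Matrix.one_apply]
      · simp [h2, h3]
  · ext j
    rw [hwc, mem_wingCols, Set.mem_ofPred_eq, sip_append_singleton hc.nodup_left,
      sip_append_singleton hc.nodup_right, add_sub_cancel_right, sub_add_eq_sub_sub_swap]
  · intro j hj
    rw [hwr] at hj
    have hlt := rank_lt_card hj
    refine ⟨rank (wingRows k q (z.map fun x => x + (k : ℤ))) j + 1, by omega, by omega, ?_⟩
    ext b x
    have h1 : blockRow (gfp k P q z * blockPerm n r) j b x =
        block (gfp k P q z * blockPerm n r) j x.1 b x.2 := rfl
    rw [h1, block_mul_blockPerm, hrow j hj]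
    simp only [unitRow, unitCol, Matrix.add_apply, Matrix.neg_apply, Matrix.smul_apply,
      Matrix.of_apply, Matrix.transpose_apply, add_left_inj]
    by_cases h2 : (x.1 : ℕ) = rank (wingRows k q (z.map fun x => x + (k : ℤ))) j
    · simp [h2, Matrix.one_apply, eq_comm]
    · by_cases h3 : (x.1 : ℕ) = rank (wingRows k q (z.map fun x => x + (k : ℤ))) j + 1
      · simp [h3, Matrix.one_apply, eq_comm]
      · simp [h2, h3]
  · ext j
    rw [hwr, mem_wingRows, Set.mem_ofPred_eq, List.singleton_append, List.singleton_append,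
      sip_cons hc.nodup_left, sip_cons hc.nodup_right, add_sub_cancel_right,
      sub_add_eq_sub_sub_swap]
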